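/- Let $t>0$, let $\mathbb H$ and $\mathbb D$ be the open upper half-plane and the open unit disk, and let $\mathbb T$ be the unit circle. For a probability measure $\mu$ on $\mathbb T$ with $\int u\,\mu(du)\neq 0$ put $\psi_\mu(z)=\int_{\mathbb T}\frac{uz}{1-uz}\,\mu(du)$ and $S_\mu(z)=\frac{1+z}{z}\psi_\mu^{-1}(z)$ for small $z\ne 0$. The free unitary Poisson distribution $\Pi_t$ is the unique probability measure on $\mathbb T$ with $S_{\Pi_t}(z)=\exp\{t/(z+\frac12)\}$ near $0$; it exists. For $\theta\in\mathbb H$ let $\zeta_t(\theta)$ be the unique solution $\zeta\in\mathbb H$ of $\zeta-t\tan\zeta=\theta$. The function $\zeta_t$ is analytic on $\mathbb H$ and extends continuously to $\overline{\mathbb H}$, and $\zeta_t(\theta)=\theta+it\,r_t(e^{2i\theta})$ on $\overline{\mathbb H}$ with a function $r_t$ that is analytic on $\mathbb D$ and continuous on $\overline{\mathbb D}$. Densities are taken with respect to the length measure on $\mathbb T$. (1) For $t>1$, $\Pi_t$ is absolutely continuous and its density is real-analytic, strictly positive and given by $$f_t(e^{i\theta})=\frac1{2\pi}\operatorname{Re}\frac1{r_t(e^{i\theta})}=-\frac1{2\pi}\operatorname{Im}\cot\zeta_t(\theta/2),\qquad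 \theta\in\mathbb R.$$ (2) For $0<t\le 1$, $\Pi_t=(1-t)\delta_1+\Pi_t^*$, where $\Pi_t^*$ is absolutely continuous with density $f_t$ given by the same two formulas on $\mathbb T\setminus\{1\}$, and $f_t(1)=0$ if $t<1$, $f_t(1)=+\infty$ if $t=1$. (3) For $0<t<1$ let $$x_t=\arccos\sqrt t-\sqrt{t(1-t)}=\frac\pi2-\int_0^t\sqrt{\frac{1-u}{u}}\,du .$$ Then $0<x_t<\pi/2$, and $\theta\mapsto f_t(e^{i\theta})$ is continuous on $[-\pi,\pi]$, vanishes on $[-2x_t,2x_t]$, and is real-analytic and strictly positive on $[-\pi,\pi]\setminus[-2x_t,2x_t]$. It has square-root singularities at $\pm2x_t$: at each of the two points there is a function $g$, real-analytic near $0$, with $g(0)=0$, $g'(0)\ne0$ and $f_t(e^{\pm i(2x_t+s)})=g(\sqrt s)$ for all sufficiently small $s\ge0$. (4) For $t=1$, $\theta\mapsto f_1(e^{i\theta})$ is real-analytic and strictly positive on $[-\pi,\pi]\setminus\{0\}$, and $$f_1(e^{i\theta})\sim\frac1{2\pi}\left(\frac{\sqrt3}{4|\theta|}\right)^{1/3}\qquad\text{as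 }\theta\to0 .$$ -/

import Mathlib

open MeasureTheory Set Filter Topology
open scoped ENNReal

noncomputable section

namespace FreePoisson

/-- The unit circle carries its Borel `σ`-algebra. -/
instance circleMeasurableSpace : MeasurableSpace Circle := borel Circle

instance circleBorelSpace : BorelSpace Circle := ⟨rfl⟩

/-- The transform `ψ_μ(z) = ∫ u z / (1 - u z) dμ(u)` of a measure on the unit circle
(used for `|z| < 1`). -/
def psi (μ : Measure Circle) (z : ℂ) : ℂ :=
  ∫ u : Circle, (u : ℂ) * z / (1 - (u : ℂ) * z) ∂μ

/-- `χ` is the (germ at `0` of the) compositional inverse of `ψ` fixing `0`. -/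
def IsInverseAtZero (ψ χ : ℂ → ℂ) : Prop :=
  AnalyticAt ℂ χ 0 ∧ χ 0 = 0 ∧ (∀ᶠ z in 𝓝 0, ψ (χ z) = z) ∧ (∀ᶠ z in 𝓝 0, χ (ψ z) = z)

/-- `S` is, for small `z ≠ 0`, the `S`-transform `S_μ(z) = ((1 + z) / z) ψ_μ⁻¹(z)` of the
measure `μ`, whose first moment is required to be nonzero. -/
def HasSTransform (μ : Measure Circle) (S : ℂ → ℂ) : Prop :=
  (∫ u : Circle, (u : ℂ) ∂μ) ≠ 0 ∧
    ∃ χ : ℂ → ℂ, IsInverseAtZero (psi μ) χ ∧ ∀ᶠ z in 𝓝[≠] 0, S z = (1 + z) / z * χ z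

/-- `μ` is the free unitary Poisson distribution with parameter `t`: the probability measure on
the unit circle with `S`-transform `exp (t / (z + 1/2))`. -/
def IsFreeUnitaryPoisson (t : ℝ) (μ : Measure Circle) : Prop :=
  IsProbabilityMeasure μ ∧ HasSTransform μ (fun z => Complex.exp (t / (z + 1 / 2)))

/-- The length measure on the unit circle (of total mass `2π`). -/
def lengthMeasure : Measure Circle :=
  (volume.restrict (Ioc (-Real.pi) Real.pi)).map Circle.exp

/-- The solution in the open upper half-plane of `ζ - t tan ζ = θ`, for `θ` in the open upper
half-plane. -/
def zetaUpper (t : ℝ) (θ : ℂ) : ℂ :=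
  Classical.epsilon fun ζ : ℂ => 0 < ζ.im ∧ ζ - t * Complex.tan ζ = θ

/-- The principal branch `ζ_t`, extended by continuity to the closed upper half-plane. -/
def zeta (t : ℝ) : ℂ → ℂ :=
  extendFrom {θ : ℂ | 0 < θ.im} (zetaUpper t)

/-- The function `r_t` on the closed unit disk, determined by
`ζ_t(θ) = θ + i t r_t(exp (2 i θ))` and `r_t(0) = 1`. -/
def r (t : ℝ) (z : ℂ) : ℂ :=
  if z = 0 then 1
  else (zeta t (Complex.log z / (2 * Complex.I)) - Complex.log z / (2 * Complex.I)) /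
    (Complex.I * t)

open Classical in
/-- The density `(1 / 2π) Re (1 / r_t(z))` on the unit circle; if `t ≤ 1` its value at `z = 1`,
where `r_t` vanishes, is `0` for `t < 1` and `+∞` for `t = 1`. -/
def density (t : ℝ) (z : Circle) : ℝ≥0∞ :=
  if t ≤ 1 ∧ z = 1 then (if t < 1 then 0 else ⊤)
  else ENNReal.ofReal (1 / (2 * Real.pi) * (1 / r t (z : ℂ)).re)

/-- The finite values of the density in the angular variable: `θ ↦ f(exp (i θ))`. -/
def angularDensity (t θ : ℝ) : ℝ := (density t (Circle.exp θ)).toReal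

/-- `x_t = arccos √t - √(t (1 - t))`. -/
def edge (t : ℝ) : ℝ := Real.arccos (√t) - √(t * (1 - t))

/-- `h(s)`, `s ≥ 0`, has a square-root singularity (of a density edge) at `s = 0`: it is an
analytic function of `√s` with vanishing constant term and nonvanishing linear term. -/
def HasSqrtEdge (h : ℝ → ℝ) : Prop :=
  ∃ g : ℝ → ℝ, AnalyticAt ℝ g 0 ∧ g 0 = 0 ∧ deriv g 0 ≠ 0 ∧ ∀ᶠ s in 𝓝[≥] 0, h s = g (√s)

end FreePoisson

end

open FreePoisson

/-!
The density of the free unitary Poisson distribution `Π_t` is read off from the boundary values of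
`1 / r_t`, the Herglotz transform of `Π_t`; everything rests on a global inverse of `F(ζ) = ζ - t
tan ζ`.

*The principal branch.* The closed region `region t`, given by `Im ζ ≥ 0` and `t sinh (2 y) / (2 y)
≤ |cos ζ|²` with `y = Im ζ`, is where `Im F ≥ 0`, suitably completed on the real axis. On it `F` is
injective, because a solution of `F(ζ) = F(ω)` would be a pair of points whose hyperbolic distance
is not strictly decreased by `tan` (`injOn_tanMap`, from the elementary two-point inequality
`normSq_sin_sub_lt`); it is proper, because `tan` is bounded on the region; and its derivative does
not vanish off the real axis. Hence the image of the interior is open and relatively closed in the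
upper half-plane (`surjOn_tanMap`), `F` is a homeomorphism of the region onto the closed half-plane,
and `ζ_t` is its inverse. Moreover `ζ_t` is holomorphic at every boundary point where it is not real
(`exists_analyticAt_eq_zeta`).

*The measure.* With `z = exp (2 i θ)`, the function `r_t(z) = -i tan ζ_t(θ)` satisfies `z = (1 - r)
/ (1 + r) exp (2 t r)` and `Re r ≥ 0`, so `1 / r_t` has positive real part on the disk. The measures
with densities `Re (1 / r_t(ρ u)) / 2π` are probability measures; a limit point as `ρ → 1` exists by
compactness and has Herglotz transform `1 / r_t` by the Schwarz formula (`exists_herglotz_measure`),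
which is the required `S`-transform in disguise (`isFreeUnitaryPoisson_of_herglotz`). Uniqueness
holds because the germ of `ψ` determines the moments (`IsFreeUnitaryPoisson.unique`). Since `(1 - z)
/ r_t(z)` is continuous on the closed disk, dominated convergence with the weight `|1 - u|`
identifies the limit away from `1`, and the mass at `1` is half the value of this function at `z =
1`, that is `max (1 - t) 0` (`exists_herglotz_poisson`).

*The density.* It equals `(1 / 2π) y sinh (2 y) / (2 y) / |sin ζ|²` at `ζ = ζ_t(θ / 2)`, so it is
analytic and positive where `ζ_t` is not real. For `t ≤ 1`, `ζ_t` is real precisely over the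
translates of `[-x_t, x_t]` by multiples of `π`, and `x_t = F(arccos √t)` is a critical value; for
`t > 1` it is never real. For `t < 1` this critical value is simple, which makes `ζ_t` an analytic
function of a square root (`hasSqrtEdge_right`). For `t = 1` the critical point is `0` and has order
two; `F(ζ) ∼ -ζ³ / 3` together with `|sin ζ|² ∼ 4 y² / 3` gives the cube of the density
(`tendsto_cube_angularDensity_one`).
-/

/-! ### Hyperbolic inequalities for `tan` -/

namespace FreePoisson

/-- The entire function `sinh (2 y) / (2 y)`, equal to `1` at `y = 0`. It measures how much the
imaginary part of `tan` exceeds `y / |cos|²`, see `im_tan`. -/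
noncomputable def shc (y : ℝ) : ℝ := dslope Real.sinh 0 (2 * y)

lemma shc_zero : shc 0 = 1 := by simp [shc]

lemma two_mul_shc (y : ℝ) : 2 * y * shc y = Real.sinh (2 * y) := by
  have h := sub_smul_dslope Real.sinh 0 (2 * y)
  simpa [shc] using h

lemma shc_of_ne {y : ℝ} (hy : y ≠ 0) : shc y = Real.sinh (2 * y) / (2 * y) := by
  rw [← two_mul_shc]; field_simp

lemma continuous_shc : Continuous shc := by
  have : Continuous (dslope Real.sinh 0) := by
    rw [← continuousOn_univ, continuousOn_dslope Filter.univ_mem]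
    exact ⟨Real.continuous_sinh.continuousOn, Real.differentiableAt_sinh⟩
  exact this.comp (continuous_const.mul continuous_id)

lemma sinh_lt_mul_cosh {x : ℝ} (hx : 0 < x) : Real.sinh x < x * Real.cosh x := by
  have hmono : StrictMonoOn (fun y : ℝ => y * Real.cosh y - Real.sinh y) (Ici 0) := by
    apply strictMonoOn_of_deriv_pos (convex_Ici 0) (by fun_prop)
    intro y hy
    rw [interior_Ici] at hy
    have hy' : 0 < y := hy
    have : HasDerivAt (fun y : ℝ => y * Real.cosh y - Real.sinh y)
        (1 * Real.cosh y + y * Real.sinh y - Real.cosh y) y :=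
      ((hasDerivAt_id y).mul (Real.hasDerivAt_cosh y)).sub (Real.hasDerivAt_sinh y)
    rw [this.deriv]
    have := mul_pos hy' (Real.sinh_pos_iff.2 hy')
    linarith
  have h1 := hmono (mem_Ici.2 le_rfl) (mem_Ici.2 hx.le) hx
  simp at h1
  linarith

lemma strictMonoOn_sinh_div : StrictMonoOn (fun x : ℝ => Real.sinh x / x) (Ioi 0) := by
  apply strictMonoOn_of_deriv_pos (convex_Ioi 0)
  · exact ContinuousOn.div Real.continuous_sinh.continuousOn continuousOn_id
      fun x hx => (mem_Ioi.1 hx).ne'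
  · intro x hx
    rw [interior_Ioi] at hx
    have hx' : 0 < x := hx
    have h2 : HasDerivAt (fun x : ℝ => Real.sinh x / x)
        ((Real.cosh x * x - Real.sinh x * 1) / x ^ 2) x :=
      (Real.hasDerivAt_sinh x).div (hasDerivAt_id x) hx'.ne'
    rw [h2.deriv]
    have := sinh_lt_mul_cosh hx'
    exact div_pos (by linarith) (by positivity)

lemma one_lt_shc {y : ℝ} (hy : 0 < y) : 1 < shc y := by
  rw [shc_of_ne hy.ne', one_lt_div (by positivity)]
  exact Real.self_lt_sinh_iff.2 (by positivity)

lemma one_le_shc {y : ℝ} (hy : 0 ≤ y) : 1 ≤ shc y := by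
  rcases hy.eq_or_lt with rfl | h
  · rw [shc_zero]
  · exact (one_lt_shc h).le

/-- The one-dimensional hyperbolic contraction property of `tan` along the imaginary direction. -/
lemma sinh_sub_sq_lt {a b : ℝ} (ha : 0 ≤ a) (hb : 0 ≤ b) (hab : a ≠ b) :
    Real.sinh (a - b) ^ 2 < (a - b) ^ 2 * (shc a * shc b) := by
  wlog h : b < a generalizing a b
  · have := this hb ha hab.symm (lt_of_le_of_ne (not_lt.1 h) hab)
    rw [← neg_sub a b, Real.sinh_neg] at this
    linarith
  have hq : 0 < a - b := sub_pos.2 h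
  rcases hb.eq_or_lt with rfl | hb
  · have ha' : 0 < a := h
    rw [shc_zero, mul_one, sub_zero]
    have h1 := two_mul_shc a
    rw [Real.sinh_two_mul] at h1
    have hc := sinh_lt_mul_cosh ha'
    have hs := Real.sinh_pos_iff.2 ha'
    nlinarith
  · have hp : 0 < a + b := by linarith
    have hlt : Real.sinh (a - b) / (a - b) < Real.sinh (a + b) / (a + b) :=
      strictMonoOn_sinh_div (mem_Ioi.2 hq) (mem_Ioi.2 hp) (by linarith)
    rw [div_lt_div_iff₀ hq hp] at hlt
    have hsq : (Real.sinh (a - b) * (a + b)) ^ 2 < (Real.sinh (a + b) * (a - b)) ^ 2 :=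
      pow_lt_pow_left₀ hlt (by positivity) two_ne_zero
    -- product formula: it turns the claim into the monotonicity of `sinh x / x`
    have hprod : Real.sinh (2 * a) * Real.sinh (2 * b) =
        Real.sinh (a + b) ^ 2 - Real.sinh (a - b) ^ 2 := by
      rw [Real.sinh_two_mul, Real.sinh_two_mul, Real.sinh_add, Real.sinh_sub]; ring
    rw [← two_mul_shc, ← two_mul_shc] at hprod
    have hab' : 0 < 4 * a * b := by have := mul_pos (hb.trans h) hb; linarith
    refine lt_of_mul_lt_mul_left ?_ hab'.le
    nlinarith

lemma normSq_cos (z : ℂ) :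
    Complex.normSq (Complex.cos z) = Real.cos z.re ^ 2 + Real.sinh z.im ^ 2 := by
  have h : Complex.cos z = (Real.cos z.re * Real.cosh z.im : ℝ) -
      (Real.sin z.re * Real.sinh z.im : ℝ) * Complex.I := by
    conv_lhs => rw [← Complex.re_add_im z, Complex.cos_add_mul_I]
    push_cast; ring
  rw [h, Complex.normSq_apply]
  simp only [Complex.sub_im, Complex.sub_re, Complex.ofReal_re,
    Complex.ofReal_im, Complex.mul_re, Complex.mul_im, Complex.I_re, Complex.I_im]
  linear_combination Real.cos z.re ^ 2 * Real.cosh_sq z.im +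
    Real.sinh z.im ^ 2 * Real.sin_sq_add_cos_sq z.re

lemma normSq_sin (z : ℂ) :
    Complex.normSq (Complex.sin z) = Real.sin z.re ^ 2 + Real.sinh z.im ^ 2 := by
  have h : Complex.sin z = (Real.sin z.re * Real.cosh z.im : ℝ) +
      (Real.cos z.re * Real.sinh z.im : ℝ) * Complex.I := by
    conv_lhs => rw [← Complex.re_add_im z, Complex.sin_add_mul_I]
    push_cast; ring
  rw [h, Complex.normSq_apply]
  simp only [Complex.add_re, Complex.add_im, Complex.ofReal_re,
    Complex.ofReal_im, Complex.mul_re, Complex.mul_im, Complex.I_re, Complex.I_im]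
  linear_combination Real.sin z.re ^ 2 * Real.cosh_sq z.im +
    Real.sinh z.im ^ 2 * Real.sin_sq_add_cos_sq z.re

/-- The imaginary part of `sin · conj cos`. -/
lemma im_sin_mul_conj_cos (z : ℂ) :
    (Complex.sin z * (starRingEnd ℂ) (Complex.cos z)).im = z.im * shc z.im := by
  have h : Complex.sin z = (Real.sin z.re * Real.cosh z.im : ℝ) +
      (Real.cos z.re * Real.sinh z.im : ℝ) * Complex.I := by
    conv_lhs => rw [← Complex.re_add_im z, Complex.sin_add_mul_I]
    push_cast; ring
  have h' : Complex.cos z = (Real.cos z.re * Real.cosh z.im : ℝ) -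
      (Real.sin z.re * Real.sinh z.im : ℝ) * Complex.I := by
    conv_lhs => rw [← Complex.re_add_im z, Complex.cos_add_mul_I]
    push_cast; ring
  have h2 := two_mul_shc z.im
  rw [Real.sinh_two_mul] at h2
  rw [h, h']
  simp only [map_sub, map_mul, Complex.conj_ofReal, Complex.conj_I, Complex.mul_im,
    Complex.add_re, Complex.add_im, Complex.sub_im, Complex.sub_re, Complex.ofReal_re,
    Complex.ofReal_im, Complex.mul_re, Complex.I_re, Complex.I_im, Complex.neg_re, Complex.neg_im]
  linear_combination -(1 / 2 : ℝ) * h2 + Real.cosh z.im * Real.sinh z.im *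
    Real.sin_sq_add_cos_sq z.re

lemma im_tan (z : ℂ) :
    (Complex.tan z).im = z.im * shc z.im / Complex.normSq (Complex.cos z) := by
  rw [Complex.tan, div_eq_mul_inv, Complex.inv_def, ← mul_assoc, Complex.im_mul_ofReal,
    im_sin_mul_conj_cos, div_eq_mul_inv]

lemma im_cot (z : ℂ) :
    (Complex.cot z).im = -(z.im * shc z.im / Complex.normSq (Complex.sin z)) := by
  have h := im_sin_mul_conj_cos z
  have h' : (Complex.cos z * (starRingEnd ℂ) (Complex.sin z)).im = -(z.im * shc z.im) := by
    rw [← h, ← Complex.conj_im]; simp [mul_comm]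
  rw [Complex.cot, div_eq_mul_inv, Complex.inv_def, ← mul_assoc, Complex.im_mul_ofReal,
    h', div_eq_mul_inv, neg_mul]

/-- A two-point Schwarz–Pick inequality for `tan`, in a form that stays meaningful on the real
axis. -/
lemma normSq_sin_sub_lt {z w : ℂ} (hz : 0 ≤ z.im) (hw : 0 ≤ w.im) (h : z ≠ w) :
    Complex.normSq (Complex.sin (z - w)) <
      Complex.normSq (z - w) * (shc z.im * shc w.im) := by
  rw [normSq_sin, Complex.normSq_apply, Complex.sub_re, Complex.sub_im]
  have h1 : 1 ≤ shc z.im * shc w.im :=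
    one_le_mul_of_one_le_of_one_le (one_le_shc hz) (one_le_shc hw)
  have h2 : Real.sin (z.re - w.re) ^ 2 ≤ (z.re - w.re) ^ 2 := Real.sin_sq_le_sq
  rcases eq_or_ne z.im w.im with him | him
  · have hre : z.re - w.re ≠ 0 := fun hre => h (Complex.ext (sub_eq_zero.1 hre) him)
    have h3 : Real.sin (z.re - w.re) ^ 2 < (z.re - w.re) ^ 2 := Real.sin_sq_lt_sq hre
    rw [him, sub_self, Real.sinh_zero]
    rw [him] at h1
    nlinarith [sq_nonneg (z.re - w.re)]
  · have h3 := sinh_sub_sq_lt hz hw him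
    nlinarith [sq_nonneg (z.re - w.re)]

end FreePoisson

/-! ### The map `ζ ↦ ζ - t tan ζ` and its inverse `ζ_t` -/

namespace FreePoisson

/-- The map `ζ ↦ ζ - t tan ζ`, whose right inverse is `ζ_t`. -/
noncomputable def tanMap (t : ℝ) (ζ : ℂ) : ℂ := ζ - t * Complex.tan ζ

/-- The closed region on which `tanMap t` restricts to a homeomorphism onto the closed upper
half-plane. Off the real axis it is the set where `tanMap t` has nonnegative imaginary part; on the
real axis it is the closure of that set. -/
def region (t : ℝ) : Set ℂ :=
  {ζ | 0 ≤ ζ.im ∧ t * shc ζ.im ≤ Complex.normSq (Complex.cos ζ)}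

variable {t : ℝ}

lemma isClosed_region : IsClosed (region t) := by
  apply IsClosed.inter
  · exact isClosed_le continuous_const Complex.continuous_im
  · exact isClosed_le (continuous_const.mul (continuous_shc.comp Complex.continuous_im))
      (Complex.continuous_normSq.comp Complex.continuous_cos)

lemma le_normSq_cos (ht : 0 < t) {ζ : ℂ} (h : ζ ∈ region t) :
    t ≤ Complex.normSq (Complex.cos ζ) :=
  le_trans (by nlinarith [one_le_shc h.1]) h.2

lemma cos_ne_zero (ht : 0 < t) {ζ : ℂ} (h : ζ ∈ region t) : Complex.cos ζ ≠ 0 := fun h0 => by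
  have := le_normSq_cos ht h
  rw [h0, map_zero] at this
  linarith

lemma cos_ne_zero_of_im_pos {ζ : ℂ} (h : 0 < ζ.im) : Complex.cos ζ ≠ 0 := fun h0 => by
  have h1 := normSq_cos ζ
  have := Real.sinh_pos_iff.2 h
  rw [h0, map_zero] at h1
  nlinarith [sq_nonneg (Real.cos ζ.re)]

lemma sin_ne_zero_of_im_pos {ζ : ℂ} (h : 0 < ζ.im) : Complex.sin ζ ≠ 0 := fun h0 => by
  have h1 := normSq_sin ζ
  have := Real.sinh_pos_iff.2 h
  rw [h0, map_zero] at h1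
  nlinarith [sq_nonneg (Real.sin ζ.re)]

lemma im_tanMap (t : ℝ) (ζ : ℂ) :
    (tanMap t ζ).im = ζ.im * (1 - t * shc ζ.im / Complex.normSq (Complex.cos ζ)) := by
  rw [tanMap, Complex.sub_im, Complex.im_ofReal_mul, im_tan]; ring

lemma im_tanMap_nonneg (ht : 0 < t) {ζ : ℂ} (h : ζ ∈ region t) : 0 ≤ (tanMap t ζ).im := by
  rw [im_tanMap]
  have := ht.trans_le (le_normSq_cos ht h)
  exact mul_nonneg h.1 (sub_nonneg.2 ((div_le_one this).2 h.2))

lemma mem_region_of_im_tanMap_nonneg {ζ : ℂ} (h : 0 < ζ.im) (h' : 0 ≤ (tanMap t ζ).im) :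
    ζ ∈ region t := by
  rw [im_tanMap] at h'
  have h1 := nonneg_of_mul_nonneg_right h' h
  have h2 : 0 < Complex.normSq (Complex.cos ζ) := Complex.normSq_pos.2 (cos_ne_zero_of_im_pos h)
  exact ⟨h.le, (div_le_one h2).1 (by linarith)⟩

lemma lt_normSq_cos_of_im_tanMap_pos {ζ : ℂ} (h : 0 < ζ.im) (h' : 0 < (tanMap t ζ).im) :
    t * shc ζ.im < Complex.normSq (Complex.cos ζ) := by
  rw [im_tanMap] at h'
  have h1 := pos_of_mul_pos_right h' h.le
  have h2 : 0 < Complex.normSq (Complex.cos ζ) := Complex.normSq_pos.2 (cos_ne_zero_of_im_pos h)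
  exact (div_lt_one h2).1 (by linarith)

lemma im_pos_of_im_tanMap_pos {ζ : ℂ} (h : 0 ≤ ζ.im) (h' : 0 < (tanMap t ζ).im) :
    0 < ζ.im := by
  rcases h.eq_or_lt with h | h
  · rw [im_tanMap, ← h, zero_mul] at h'; exact absurd h' (lt_irrefl _)
  · exact h

/-- If `z` and `w` have the same image, then `z - w = t tan z - t tan w`; as `t tan` does not
increase imaginary parts on the region, the hyperbolic distance of `z` and `w` is at most that of
their images under `t tan`, which contradicts the strict Schwarz–Pick inequality. -/
lemma injOn_tanMap (ht : 0 < t) : InjOn (tanMap t) (region t) := by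
  intro z hz w hw h
  by_contra hne
  have hcz := cos_ne_zero ht hz
  have hcw := cos_ne_zero ht hw
  have h1 : (z - w) * (Complex.cos z * Complex.cos w) = t * Complex.sin (z - w) := by
    have : z - w = t * (Complex.tan z - Complex.tan w) := by
      simp only [tanMap] at h; linear_combination h
    rw [Complex.sin_sub, this, Complex.tan, Complex.tan]
    field_simp
  have h2 := congrArg Complex.normSq h1
  simp only [map_mul, Complex.normSq_ofReal] at h2
  have h3 := normSq_sin_sub_lt hz.1 hw.1 hne
  have h4 : (t * shc z.im) * (t * shc w.im) ≤
      Complex.normSq (Complex.cos z) * Complex.normSq (Complex.cos w) :=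
    mul_le_mul hz.2 hw.2 (mul_nonneg ht.le (zero_le_one.trans (one_le_shc hw.1)))
      (Complex.normSq_nonneg _)
  have h5 := mul_le_mul_of_nonneg_left h4 (Complex.normSq_nonneg (z - w))
  have h6 := mul_lt_mul_of_pos_left h3 (mul_pos ht ht)
  rw [h2] at h5
  nlinarith

lemma norm_tan_le (ht : 0 < t) {ζ : ℂ} (h : ζ ∈ region t) :
    ‖Complex.tan ζ‖ ≤ √(1 + 1 / t) := by
  apply Real.le_sqrt_of_sq_le
  have h1 := le_normSq_cos ht h
  have h0 := ht.trans_le h1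
  rw [← Complex.normSq_eq_norm_sq, Complex.tan, Complex.normSq_div, div_le_iff₀ h0]
  have h2 := normSq_cos ζ
  have h3 := normSq_sin ζ
  have h4 : 1 ≤ 1 / t * Complex.normSq (Complex.cos ζ) := by
    rw [one_div, inv_mul_eq_div, le_div_iff₀ ht]; linarith
  nlinarith [Real.sin_sq_add_cos_sq ζ.re, sq_nonneg (Real.cos ζ.re)]

lemma continuousOn_tanMap (ht : 0 < t) : ContinuousOn (tanMap t) (region t) := by
  refine continuousOn_id.sub (continuousOn_const.mul ?_)
  intro ζ h
  exact (Complex.continuousAt_tan.2 (cos_ne_zero ht h)).continuousWithinAt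

lemma hasStrictDerivAt_tanMap {ζ : ℂ} (h : Complex.cos ζ ≠ 0) :
    HasStrictDerivAt (tanMap t) (1 - t * (1 / Complex.cos ζ ^ 2)) ζ :=
  (hasStrictDerivAt_id ζ).sub ((Complex.hasStrictDerivAt_tan h).const_mul _)

lemma analyticAt_tan {ζ : ℂ} (h : Complex.cos ζ ≠ 0) : AnalyticAt ℂ Complex.tan ζ :=
  Complex.analyticAt_sin.div Complex.analyticAt_cos h

lemma analyticAt_tanMap {ζ : ℂ} (h : Complex.cos ζ ≠ 0) : AnalyticAt ℂ (tanMap t) ζ :=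
  analyticAt_id.sub (analyticAt_const.mul (analyticAt_tan h))

/-- Critical points of `tanMap t` in the region lie on the real axis. -/
lemma deriv_tanMap_ne_zero (ht : 0 < t) {ζ : ℂ} (h : ζ ∈ region t) (him : 0 < ζ.im) :
    1 - t * (1 / Complex.cos ζ ^ 2) ≠ 0 := by
  intro h0
  have hc := cos_ne_zero ht h
  have h1 : Complex.cos ζ ^ 2 = t := by
    field_simp at h0
    linear_combination h0
  have h2 := congrArg norm h1
  rw [norm_pow, ← Complex.normSq_eq_norm_sq, Complex.norm_real, Real.norm_of_nonneg ht.le] at h2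
  have h3 := h.2
  rw [h2] at h3
  nlinarith [one_lt_shc him]

/-- `tanMap t` is proper on the region: there it differs from the identity by a bounded function. -/
lemma isClosedEmbedding_tanMap (ht : 0 < t) :
    IsClosedEmbedding ((region t).domRestrict (tanMap t)) := by
  have hcont : Continuous ((region t).domRestrict (tanMap t)) :=
    continuousOn_iff_continuous_domRestrict.1 (continuousOn_tanMap ht)
  refine .of_continuous_injective_isClosedMap hcont (injOn_iff_injective.1 (injOn_tanMap ht)) ?_
  refine (isProperMap_iff_tendsto_cocompact.2 ⟨hcont, ?_⟩).isClosedMap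
  rw [← Metric.cobounded_eq_cocompact (α := ℂ), ← tendsto_norm_atTop_iff_cobounded]
  have h1 : Tendsto (fun ζ : region t => ‖(ζ : ℂ)‖ - t * √(1 + 1 / t))
      (cocompact (region t)) atTop :=
    tendsto_atTop_add_const_right _ _ (tendsto_norm_cocompact_atTop.comp
      isClosed_region.isClosedEmbedding_subtypeVal.tendsto_cocompact)
  refine tendsto_atTop_mono (fun ζ => ?_) h1
  have h2 : ‖(t : ℂ) * Complex.tan ζ‖ ≤ t * √(1 + 1 / t) := by
    rw [norm_mul, Complex.norm_real, Real.norm_of_nonneg ht.le]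
    exact mul_le_mul_of_nonneg_left (norm_tan_le ht ζ.2) ht.le
  have h3 := norm_sub_norm_le (ζ : ℂ) (t * Complex.tan ζ)
  simp only [domRestrict_apply, tanMap]
  linarith

/-- The image of the part of the region lying over the open upper half-plane is open (the derivative
does not vanish) and relatively closed (`tanMap t` is proper), so it is the whole half-plane. -/
lemma surjOn_tanMap (ht : 0 < t) : SurjOn (tanMap t) (region t) {θ | 0 ≤ θ.im} := by
  set Ω : Set ℂ := {ζ | 0 < ζ.im ∧ t * shc ζ.im < Complex.normSq (Complex.cos ζ)}
  have hΩ : IsOpen Ω := by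
    apply IsOpen.inter
    · exact isOpen_lt continuous_const Complex.continuous_im
    · exact isOpen_lt (continuous_const.mul (continuous_shc.comp Complex.continuous_im))
        (Complex.continuous_normSq.comp Complex.continuous_cos)
  have hΩsub : Ω ⊆ region t := fun ζ h => ⟨h.1.le, h.2.le⟩
  have himg : ∀ ζ ∈ Ω, 0 < (tanMap t ζ).im := by
    intro ζ h
    rw [im_tanMap]
    have : 0 < Complex.normSq (Complex.cos ζ) := ht.trans_le (le_normSq_cos ht (hΩsub h))
    exact mul_pos h.1 (sub_pos.2 ((div_lt_one this).2 h.2))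
  have hopen : IsOpen (tanMap t '' Ω) := by
    rw [isOpen_iff_mem_nhds]
    rintro _ ⟨ζ, h, rfl⟩
    rw [← (hasStrictDerivAt_tanMap (cos_ne_zero ht (hΩsub h))).map_nhds_eq
      (deriv_tanMap_ne_zero ht (hΩsub h) h.1)]
    exact image_mem_map (hΩ.mem_nhds h)
  have hclosed : IsClosed (tanMap t '' region t) := by
    have := (isClosedEmbedding_tanMap ht).isClosed_range
    rwa [range_domRestrict] at this
  have hpre : IsPreconnected {θ : ℂ | 0 < θ.im} :=
    (convex_halfSpace_im_gt 0).isPreconnected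
  have hne : ({θ : ℂ | 0 < θ.im} ∩ tanMap t '' Ω).Nonempty := by
    suffices h : Ω.Nonempty by
      obtain ⟨ζ, h⟩ := h
      exact ⟨_, himg ζ h, ζ, h, rfl⟩
    -- far up the imaginary axis, `cosh²` dominates `sinh (2 y) / (2 y)`
    refine ⟨((t + 1 : ℝ) : ℂ) * Complex.I, ?_, ?_⟩
    · simp; linarith
    · have h1 : (((t + 1 : ℝ) : ℂ) * Complex.I).im = t + 1 := by simp
      have h0 : (((t + 1 : ℝ) : ℂ) * Complex.I).re = 0 := by simp
      rw [normSq_cos, h1, h0, shc_of_ne (by positivity), Real.sinh_two_mul, Real.cos_zero]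
      have h2 : Real.sinh (t + 1) < Real.cosh (t + 1) := Real.sinh_lt_cosh _
      have h3 : 0 < Real.sinh (t + 1) := Real.sinh_pos_iff.2 (by positivity)
      have h4 := Real.cosh_sq (t + 1)
      rw [mul_div_assoc', div_lt_iff₀ (by positivity)]
      have h5 := mul_pos ht (mul_pos (sub_pos.2 h2) (h3.trans h2))
      have h6 := sq_nonneg (Real.sinh (t + 1))
      have h7 : t * Real.cosh (t + 1) ^ 2 = t * (Real.sinh (t + 1) ^ 2 + 1) := by rw [h4]
      linarith
  -- a limit of values on `Ω` is a value on `region t`; if it lies in the open half-plane, the point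
  -- of the region belongs to `Ω`
  have hsub := hpre.subset_of_closure_inter_subset hopen hne (by
    rintro θ ⟨hθ, hpos⟩
    obtain ⟨ζ, hζ, rfl⟩ := closure_minimal (image_mono hΩsub) hclosed hθ
    have hp := im_pos_of_im_tanMap_pos hζ.1 hpos
    exact ⟨ζ, ⟨hp, lt_normSq_cos_of_im_tanMap_pos hp hpos⟩, rfl⟩)
  have := closure_minimal (hsub.trans (image_mono hΩsub)) hclosed
  rwa [Complex.closure_setOfPred_lt_im] at this

lemma exists_continuous_inverse_tanMap (ht : 0 < t) : ∃ Z : ℂ → ℂ,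
    (∀ θ : ℂ, 0 ≤ θ.im → Z θ ∈ region t ∧ tanMap t (Z θ) = θ) ∧
    ContinuousOn Z {θ : ℂ | 0 ≤ θ.im} := by
  choose! Z hZ hZ' using fun θ (h : θ ∈ {θ : ℂ | 0 ≤ θ.im}) => surjOn_tanMap ht h
  refine ⟨Z, fun θ h => ⟨hZ θ h, hZ' θ h⟩, ?_⟩
  rw [continuousOn_iff_continuous_domRestrict]
  let Z' : {θ : ℂ | 0 ≤ θ.im} → region t := fun θ => ⟨Z θ, hZ θ θ.2⟩
  have : Continuous Z' := by
    rw [(isClosedEmbedding_tanMap ht).isInducing.continuous_iff]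
    have h : (region t).domRestrict (tanMap t) ∘ Z' = Subtype.val := funext fun θ => hZ' θ θ.2
    rw [h]
    exact continuous_subtype_val
  exact continuous_subtype_val.comp this

lemma zetaUpper_eq (ht : 0 < t) {θ ζ : ℂ} (hθ : 0 < θ.im) (hζ : ζ ∈ region t)
    (h : tanMap t ζ = θ) : zetaUpper t θ = ζ := by
  have hp : 0 < ζ.im := im_pos_of_im_tanMap_pos hζ.1 (h ▸ hθ)
  have hs := Classical.epsilon_spec (p := fun ζ : ℂ => 0 < ζ.im ∧ ζ - t * Complex.tan ζ = θ)
    ⟨ζ, hp, h⟩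
  have hs2 : tanMap t (zetaUpper t θ) = θ := hs.2
  exact injOn_tanMap ht (mem_region_of_im_tanMap_nonneg hs.1 (by rw [← hs2] at hθ; exact hθ.le)) hζ
    (hs2.trans h.symm)

lemma zeta_eqOn (ht : 0 < t) {Z : ℂ → ℂ}
    (hZ : ∀ θ : ℂ, 0 ≤ θ.im → Z θ ∈ region t ∧ tanMap t (Z θ) = θ)
    (hZc : ContinuousOn Z {θ : ℂ | 0 ≤ θ.im}) : EqOn (zeta t) Z {θ | 0 ≤ θ.im} := by
  intro θ hθ
  have hcl : θ ∈ closure {θ : ℂ | 0 < θ.im} := by rwa [Complex.closure_setOfPred_lt_im]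
  refine extendFrom_eq hcl ?_
  refine ((hZc θ hθ).mono_left (nhdsWithin_mono _ fun θ (h : 0 < θ.im) => h.le)).congr' ?_
  filter_upwards [self_mem_nhdsWithin] with θ hθ
  exact (zetaUpper_eq ht hθ (hZ θ (le_of_lt hθ)).1 (hZ θ (le_of_lt hθ)).2).symm

lemma zeta_mem_region (ht : 0 < t) {θ : ℂ} (hθ : 0 ≤ θ.im) : zeta t θ ∈ region t := by
  obtain ⟨Z, hZ, hZc⟩ := exists_continuous_inverse_tanMap ht
  rw [zeta_eqOn ht hZ hZc hθ]
  exact (hZ θ hθ).1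

lemma tanMap_zeta (ht : 0 < t) {θ : ℂ} (hθ : 0 ≤ θ.im) : tanMap t (zeta t θ) = θ := by
  obtain ⟨Z, hZ, hZc⟩ := exists_continuous_inverse_tanMap ht
  rw [zeta_eqOn ht hZ hZc hθ]
  exact (hZ θ hθ).2

lemma continuousOn_zeta (ht : 0 < t) : ContinuousOn (zeta t) {θ : ℂ | 0 ≤ θ.im} := by
  obtain ⟨Z, hZ, hZc⟩ := exists_continuous_inverse_tanMap ht
  exact hZc.congr (zeta_eqOn ht hZ hZc)

lemma zeta_eq (ht : 0 < t) {θ ζ : ℂ} (hζ : ζ ∈ region t) (h : tanMap t ζ = θ) :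
    zeta t θ = ζ := by
  have hθ : 0 ≤ θ.im := h ▸ im_tanMap_nonneg ht hζ
  exact injOn_tanMap ht (zeta_mem_region ht hθ) hζ ((tanMap_zeta ht hθ).trans h.symm)

lemma zeta_im_pos (ht : 0 < t) {θ : ℂ} (hθ : 0 < θ.im) : 0 < (zeta t θ).im :=
  im_pos_of_im_tanMap_pos (zeta_mem_region ht hθ.le).1 (by rwa [tanMap_zeta ht hθ.le])

/-- Where `ζ_t` is not real it agrees, on the closed half-plane, with a holomorphic function. -/
lemma exists_analyticAt_eq_zeta (ht : 0 < t) {θ : ℂ} (hθ : 0 ≤ θ.im)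
    (hne : 1 - t * (1 / Complex.cos (zeta t θ) ^ 2) ≠ 0) :
    ∃ g : ℂ → ℂ, AnalyticAt ℂ g θ ∧ ∀ᶠ w in 𝓝[{w | 0 ≤ w.im}] θ, zeta t w = g w := by
  have hc := cos_ne_zero ht (zeta_mem_region ht hθ)
  have ha := analyticAt_tanMap (t := t) hc
  have hd := (hasStrictDerivAt_tanMap (t := t) hc).hasDerivAt.deriv
  have hd' : deriv (tanMap t) (zeta t θ) ≠ 0 := by rwa [hd]
  refine ⟨ha.hasStrictDerivAt.localInverse _ _ _ hd', ?_, ?_⟩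
  rotate_left
  · have h1 := ha.hasStrictDerivAt.eventually_left_inverse hd'
    have h2 := (continuousOn_zeta ht θ hθ).eventually h1
    filter_upwards [h2, self_mem_nhdsWithin] with w hw hw'
    rw [tanMap_zeta ht hw'] at hw
    exact hw.symm
  · have := ha.analyticAt_localInverse hd'
    rwa [tanMap_zeta ht hθ] at this

lemma analyticAt_zeta (ht : 0 < t) {θ : ℂ} (hθ : 0 < θ.im) : AnalyticAt ℂ (zeta t) θ := by
  obtain ⟨g, hg, h⟩ := exists_analyticAt_eq_zeta ht hθ.le
    (deriv_tanMap_ne_zero ht (zeta_mem_region ht hθ.le) (zeta_im_pos ht hθ))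
  refine hg.congr ?_
  have hn : {w : ℂ | 0 ≤ w.im} ∈ 𝓝 θ :=
    mem_of_superset ((isOpen_lt continuous_const Complex.continuous_im).mem_nhds hθ)
      fun w (hw : 0 < w.im) => hw.le
  rw [nhdsWithin_eq_nhds.2 hn] at h
  exact h.mono fun w hw => hw.symm

end FreePoisson

/-! ### The function `r_t` on the disk -/

namespace FreePoisson

variable {t : ℝ}

lemma zeta_add_int_mul_pi (ht : 0 < t) {θ : ℂ} (hθ : 0 ≤ θ.im) (k : ℤ) :
    zeta t (θ + k * Real.pi) = zeta t θ + k * Real.pi := by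
  have h := zeta_mem_region ht hθ
  have him : (zeta t θ + k * Real.pi).im = (zeta t θ).im := by simp
  have hre : (zeta t θ + k * Real.pi).re = (zeta t θ).re + k * Real.pi := by simp
  apply zeta_eq ht
  · refine ⟨by rw [him]; exact h.1, ?_⟩
    have h2 := h.2
    rw [normSq_cos] at h2 ⊢
    rw [him, hre, Real.cos_add_int_mul_pi, mul_pow, ← zpow_natCast ((-1 : ℝ) ^ k), ← zpow_mul,
      mul_comm k, zpow_mul]
    simpa using h2
  · rw [tanMap, Complex.tan_add_int_mul_pi]
    linear_combination tanMap_zeta ht hθ - (by rw [tanMap] :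
      tanMap t (zeta t θ) = zeta t θ - t * Complex.tan (zeta t θ))

/-- Reflection in the imaginary axis. -/
lemma zeta_neg_conj (ht : 0 < t) {θ : ℂ} (hθ : 0 ≤ θ.im) :
    zeta t (-(starRingEnd ℂ) θ) = -(starRingEnd ℂ) (zeta t θ) := by
  have h := zeta_mem_region ht hθ
  apply zeta_eq ht
  · refine ⟨by simpa using h.1, ?_⟩
    have h2 := h.2
    rw [normSq_cos] at h2 ⊢
    simpa using h2
  · have h2 := congrArg (starRingEnd ℂ) (tanMap_zeta ht hθ)
    simp only [tanMap, map_sub, map_mul, Complex.conj_ofReal] at h2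
    rw [tanMap, Complex.tan_neg, Complex.tan_conj]
    linear_combination -h2

lemma r_exp (ht : 0 < t) {θ : ℂ} (hθ : 0 ≤ θ.im) :
    r t (Complex.exp (2 * Complex.I * θ)) = -Complex.I * Complex.tan (zeta t θ) := by
  have htc : (t : ℂ) ≠ 0 := by exact_mod_cast ht.ne'
  rw [r, if_neg (Complex.exp_ne_zero _)]
  obtain ⟨k, hk⟩ := Complex.exp_eq_exp_iff_exists_int.1
    (Complex.exp_log (Complex.exp_ne_zero (2 * Complex.I * θ)))
  have h1 : Complex.log (Complex.exp (2 * Complex.I * θ)) / (2 * Complex.I) =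
      θ + k * Real.pi := by
    rw [hk]; field_simp
  rw [h1, zeta_add_int_mul_pi ht hθ]
  have h2 := tanMap_zeta ht hθ
  rw [tanMap] at h2
  rw [div_eq_iff (by simp [htc])]
  linear_combination h2 + t * Complex.tan (zeta t θ) * Complex.I_sq

lemma r_zero : r t 0 = 1 := if_pos rfl

/-- A local branch `L` of `log z / (2 i)`, through which `r_t` factors as `ζ_t ∘ L` near a nonzero
point of the closed disk. -/
lemma exists_local_log (z₀ : ℂ) (h0 : z₀ ≠ 0) : ∃ L : ℂ → ℂ, AnalyticAt ℂ L z₀ ∧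
    ∀ z ≠ 0, Complex.exp (2 * Complex.I * L z) = z ∧ (L z).im = -Real.log ‖z‖ / 2 := by
  have hexp : ∀ z ≠ 0, Complex.exp (2 * Complex.I *
      ((Complex.log z₀ + Complex.log (z / z₀)) / (2 * Complex.I))) = z := by
    intro z hz
    rw [mul_div_cancel₀ _ (by simp), Complex.exp_add, Complex.exp_log h0,
      Complex.exp_log (div_ne_zero hz h0), mul_div_cancel₀ _ h0]
  refine ⟨fun z => (Complex.log z₀ + Complex.log (z / z₀)) / (2 * Complex.I), ?_, ?_⟩
  · refine AnalyticAt.div_const (analyticAt_const.add (AnalyticAt.clog ?_ ?_))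
    · exact analyticAt_id.div_const
    · simp [div_self h0]
  · intro z hz
    refine ⟨hexp z hz, ?_⟩
    have h := congrArg (fun w => Real.log ‖w‖) (hexp z hz)
    simp only [Complex.norm_exp, Real.log_exp] at h
    rw [← h]
    simp

lemma exists_exp_eq {z : ℂ} (h0 : z ≠ 0) (h1 : ‖z‖ ≤ 1) :
    ∃ θ : ℂ, 0 ≤ θ.im ∧ Complex.exp (2 * Complex.I * θ) = z := by
  obtain ⟨L, -, hL⟩ := exists_local_log z h0
  refine ⟨L z, ?_, (hL z h0).1⟩
  rw [(hL z h0).2]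
  have := Real.log_nonpos (norm_nonneg z) h1
  linarith

/-- The Cayley transform of `-i tan ζ` is `exp (2 i ζ)`. -/
lemma neg_I_mul_tan {ζ : ℂ} (hc : Complex.cos ζ ≠ 0) :
    1 + Complex.exp (2 * Complex.I * ζ) ≠ 0 ∧
    -Complex.I * Complex.tan ζ =
      (1 - Complex.exp (2 * Complex.I * ζ)) / (1 + Complex.exp (2 * Complex.I * ζ)) := by
  have he : Complex.exp (2 * Complex.I * ζ) = Complex.exp (ζ * Complex.I) ^ 2 := by
    rw [← Complex.exp_nat_mul]; congr 1; push_cast; ring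
  have hinv : Complex.exp (-ζ * Complex.I) = (Complex.exp (ζ * Complex.I))⁻¹ := by
    rw [← Complex.exp_neg]; congr 1; ring
  rw [he]
  have hcos : Complex.cos ζ = (1 + Complex.exp (ζ * Complex.I) ^ 2) /
      (2 * Complex.exp (ζ * Complex.I)) := by
    rw [Complex.cos, hinv]; field_simp; ring
  have hsin : Complex.sin ζ = (1 - Complex.exp (ζ * Complex.I) ^ 2) * Complex.I /
      (2 * Complex.exp (ζ * Complex.I)) := by
    rw [Complex.sin, hinv]; field_simp
  have h1 : 1 + Complex.exp (ζ * Complex.I) ^ 2 ≠ 0 := fun h => hc (by rw [hcos, h, zero_div])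
  refine ⟨h1, ?_⟩
  rw [Complex.tan, hcos, hsin, div_div_div_cancel_right₀ (by simp), ← mul_div_assoc]
  congr 1
  linear_combination -(1 - Complex.exp (ζ * Complex.I) ^ 2) * Complex.I_sq

/-- In terms of the Cayley transform `u` of `r_t(z)`, the defining equation reads
`z = u exp (2 t r)`, and `u` is bounded by `z`. -/
lemma exists_cayley (ht : 0 < t) {z : ℂ} (hz : ‖z‖ ≤ 1) : ∃ u : ℂ, ‖u‖ ≤ ‖z‖ ∧ 1 + u ≠ 0 ∧
    r t z = (1 - u) / (1 + u) ∧ z = u * Complex.exp (2 * t * r t z) := by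
  rcases eq_or_ne z 0 with rfl | h0
  · exact ⟨0, by simp [r_zero]⟩
  obtain ⟨θ, hθ, rfl⟩ := exists_exp_eq h0 hz
  have hreg := zeta_mem_region ht hθ
  have hF := tanMap_zeta ht hθ
  obtain ⟨h1, h2⟩ := neg_I_mul_tan (cos_ne_zero ht hreg)
  refine ⟨Complex.exp (2 * Complex.I * zeta t θ), ?_, h1, by rw [r_exp ht hθ, h2], ?_⟩
  · rw [Complex.norm_exp, Complex.norm_exp, Real.exp_le_exp]
    have h3 : 0 ≤ (Complex.tan (zeta t θ)).im := by
      rw [im_tan]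
      exact div_nonneg (mul_nonneg hreg.1 (zero_le_one.trans (one_le_shc hreg.1)))
        (Complex.normSq_nonneg _)
    have h4 := congrArg Complex.im hF
    rw [tanMap, Complex.sub_im, Complex.im_ofReal_mul] at h4
    simp
    nlinarith
  · rw [r_exp ht hθ, ← Complex.exp_add]
    congr 1
    rw [tanMap] at hF
    linear_combination -2 * Complex.I * hF

lemma re_r_nonneg (ht : 0 < t) {z : ℂ} (hz : ‖z‖ ≤ 1) : 0 ≤ (r t z).re := by
  rcases eq_or_ne z 0 with rfl | h0
  · simp [r_zero]
  obtain ⟨θ, hθ, rfl⟩ := exists_exp_eq h0 hz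
  have hreg := zeta_mem_region ht hθ
  rw [r_exp ht hθ]
  simp only [neg_mul, Complex.neg_re, Complex.I_mul_re, neg_neg]
  rw [im_tan]
  exact div_nonneg (mul_nonneg hreg.1 (zero_le_one.trans (one_le_shc hreg.1)))
    (Complex.normSq_nonneg _)

lemma one_add_r_ne_zero (ht : 0 < t) {z : ℂ} (hz : ‖z‖ ≤ 1) : 1 + r t z ≠ 0 := fun h => by
  have h1 := congrArg Complex.re h
  have := re_r_nonneg ht hz
  simp at h1
  linarith

/-- `r_t` is a right inverse of `ρ ↦ (1 - ρ) / (1 + ρ) exp (2 t ρ)`; this is where the `S`-transform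
`exp (t / (z + 1 / 2))` enters, through the substitution `ρ = 1 / (1 + 2 ψ)`. -/
lemma r_equation (ht : 0 < t) {z : ℂ} (hz : ‖z‖ ≤ 1) :
    (1 - r t z) / (1 + r t z) * Complex.exp (2 * t * r t z) = z := by
  obtain ⟨u, -, h1, h2, h3⟩ := exists_cayley ht hz
  conv_rhs => rw [h3]
  congr 1
  rw [div_eq_iff (one_add_r_ne_zero ht hz), h2]
  field_simp
  ring

lemma r_ne_zero (ht : 0 < t) {z : ℂ} (hz : ‖z‖ ≤ 1) (h1 : z ≠ 1) : r t z ≠ 0 := fun h => by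
  have := r_equation ht hz
  rw [h] at this
  simp at this
  exact h1 this.symm

lemma r_conj (ht : 0 < t) {z : ℂ} (hz : ‖z‖ ≤ 1) :
    r t ((starRingEnd ℂ) z) = (starRingEnd ℂ) (r t z) := by
  rcases eq_or_ne z 0 with rfl | h0
  · simp [r_zero]
  obtain ⟨θ, hθ, rfl⟩ := exists_exp_eq h0 hz
  have h1 : (starRingEnd ℂ) (Complex.exp (2 * Complex.I * θ)) =
      Complex.exp (2 * Complex.I * (-(starRingEnd ℂ) θ)) := by
    rw [← Complex.exp_conj]; congr 1; simp [Complex.conj_ofNat]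
  rw [h1, r_exp ht hθ, r_exp ht (by simpa using hθ), zeta_neg_conj ht hθ, Complex.tan_neg,
    Complex.tan_conj]
  simp

/-- A bound giving the continuity of `r_t` at `0`, which corresponds to `Im θ → ∞`. -/
lemma norm_r_sub_one_le (ht : 0 < t) {z : ℂ} (hz : ‖z‖ < 1) :
    ‖r t z - 1‖ ≤ 2 * ‖z‖ / (1 - ‖z‖) := by
  obtain ⟨u, hu, h1, h2, -⟩ := exists_cayley ht hz.le
  have h3 : r t z - 1 = -2 * u / (1 + u) := by rw [h2]; field_simp; ring
  have h4 : 1 - ‖z‖ ≤ ‖1 + u‖ := by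
    have := norm_sub_norm_le (1 : ℂ) (-u)
    simp at this
    linarith
  rw [h3, norm_div, norm_mul]
  simp only [norm_neg, Complex.norm_ofNat]
  exact div_le_div₀ (by positivity) (by linarith) (by linarith) h4

lemma continuousAt_r_zero (ht : 0 < t) : ContinuousAt (r t) 0 := by
  rw [ContinuousAt, tendsto_iff_norm_sub_tendsto_zero, r_zero]
  have h1 : Tendsto (fun z : ℂ => 2 * ‖z‖ / (1 - ‖z‖)) (𝓝 0) (𝓝 0) := by
    have : ContinuousAt (fun z : ℂ => 2 * ‖z‖ / (1 - ‖z‖)) 0 :=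
      ContinuousAt.div (by fun_prop) (by fun_prop) (by simp)
    simpa [ContinuousAt] using this
  refine squeeze_zero' (.of_forall fun _ => norm_nonneg _) ?_ h1
  filter_upwards [Metric.ball_mem_nhds (0 : ℂ) one_pos] with z hz
  exact norm_r_sub_one_le ht (by simpa using hz)

lemma continuousOn_r (ht : 0 < t) : ContinuousOn (r t) (Metric.closedBall 0 1) := by
  intro z₀ hz₀
  rcases eq_or_ne z₀ 0 with rfl | h0
  · exact (continuousAt_r_zero ht).continuousWithinAt
  obtain ⟨L, hLa, hL⟩ := exists_local_log z₀ h0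
  have him : ∀ z ∈ Metric.closedBall (0 : ℂ) 1, z ≠ 0 → 0 ≤ (L z).im := by
    intro z hz hz0
    rw [(hL z hz0).2]
    have := Real.log_nonpos (norm_nonneg z) (by simpa using hz)
    linarith
  have hmaps : Tendsto L (𝓝[Metric.closedBall 0 1] z₀) (𝓝[{w | 0 ≤ w.im}] L z₀) := by
    apply tendsto_nhdsWithin_of_tendsto_nhds_of_eventually_within
    · exact hLa.continuousAt.continuousWithinAt
    · filter_upwards [self_mem_nhdsWithin, mem_nhdsWithin_of_mem_nhds (isOpen_ne.mem_nhds h0)]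
        with z hz hz0 using him z hz hz0
  have hreg := zeta_mem_region ht (him z₀ hz₀ h0)
  have h1 := (continuousOn_zeta ht _ (him z₀ hz₀ h0)).tendsto.comp hmaps
  have h2 := ((Complex.continuousAt_tan.2 (cos_ne_zero ht hreg)).tendsto.comp h1).const_mul
    (-Complex.I)
  rw [ContinuousWithinAt]
  have h3 : r t z₀ = -Complex.I * Complex.tan (zeta t (L z₀)) := by
    rw [← r_exp ht (him z₀ hz₀ h0), (hL z₀ h0).1]
  rw [h3]
  refine h2.congr' ?_
  filter_upwards [self_mem_nhdsWithin, mem_nhdsWithin_of_mem_nhds (isOpen_ne.mem_nhds h0)]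
    with z hz hz0
  simp only [Function.comp]
  rw [← r_exp ht (him z hz hz0), (hL z hz0).1]

lemma analyticOnNhd_r (ht : 0 < t) : AnalyticOnNhd ℂ (r t) (Metric.ball 0 1) := by
  have key : ∀ z₀ ∈ Metric.ball (0 : ℂ) 1, z₀ ≠ 0 → AnalyticAt ℂ (r t) z₀ := by
    intro z₀ hz₀ h0
    obtain ⟨L, hLa, hL⟩ := exists_local_log z₀ h0
    have him : ∀ z ∈ Metric.ball (0 : ℂ) 1, z ≠ 0 → 0 < (L z).im := by
      intro z hz hz0
      rw [(hL z hz0).2]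
      have := Real.log_neg (norm_pos_iff.2 hz0) (by simpa using hz)
      linarith
    have h1 := (analyticAt_zeta ht (him z₀ hz₀ h0)).comp hLa
    have h2 := AnalyticAt.comp (g := Complex.tan) (f := zeta t ∘ L)
      (analyticAt_tan (cos_ne_zero_of_im_pos (zeta_im_pos ht (him z₀ hz₀ h0)))) h1
    refine ((analyticAt_const (v := -Complex.I)).mul h2).congr ?_
    filter_upwards [isOpen_ne.mem_nhds h0, Metric.isOpen_ball.mem_nhds hz₀] with z hz0 hz
    simp only [Function.comp, Pi.mul_apply]
    rw [← r_exp ht (him z hz hz0).le, (hL z hz0).1]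
  intro z₀ hz₀
  rcases eq_or_ne z₀ 0 with rfl | h0
  -- the origin, where no branch of the logarithm is available, is a removable singularity
  · refine Complex.analyticAt_of_differentiable_on_punctured_nhds_of_continuousAt ?_
      (continuousAt_r_zero ht)
    filter_upwards [self_mem_nhdsWithin,
      mem_nhdsWithin_of_mem_nhds (Metric.isOpen_ball.mem_nhds hz₀)] with z hz0 hz
    exact (key z hz hz0).differentiableAt
  · exact key z₀ hz₀ h0

end FreePoisson

/-! ### Uniqueness of the distribution -/

namespace FreePoisson

open scoped BoundedContinuousFunction

variable {t : ℝ}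

lemma integrable_circle {E : Type*} [NormedAddCommGroup E] (μ : Measure Circle)
    [IsFiniteMeasure μ] {f : Circle → E} (hf : Continuous f) : Integrable f μ :=
  hf.integrable_of_hasCompactSupport (HasCompactSupport.of_compactSpace f)

lemma continuous_coe_circle : Continuous ((↑) : Circle → ℂ) := continuous_subtype_val

lemma one_sub_mul_ne_zero (u : Circle) {z : ℂ} (hz : ‖z‖ < 1) : 1 - (u : ℂ) * z ≠ 0 := by
  intro h
  have h1 : ‖(u : ℂ) * z‖ = 1 := by rw [← sub_eq_zero.1 h, norm_one]
  rw [norm_mul, Circle.norm_coe, one_mul] at h1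
  linarith

/-- Integer powers of the coordinate, as bounded continuous functions. -/
noncomputable def circleMonomial (n : ℤ) : Circle →ᵇ ℂ :=
  BoundedContinuousFunction.mkOfCompact
    ⟨fun u => ((u ^ n : Circle) : ℂ), continuous_coe_circle.comp (continuous_zpow n)⟩

lemma circleMonomial_apply (n : ℤ) (u : Circle) :
    circleMonomial n u = ((u ^ n : Circle) : ℂ) := rfl

/-- The star algebra of Laurent polynomials on the circle. -/
noncomputable def laurentSubalgebra : StarSubalgebra ℂ (Circle →ᵇ ℂ) where
  toSubalgebra := Algebra.adjoin ℂ (range circleMonomial)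
  star_mem' := by
    change Algebra.adjoin ℂ (range circleMonomial) ≤ star (Algebra.adjoin ℂ (range circleMonomial))
    refine Algebra.adjoin_le ?_
    rintro - ⟨n, rfl⟩
    refine Algebra.subset_adjoin ⟨-n, ?_⟩
    ext u
    simp only [BoundedContinuousFunction.star_apply, circleMonomial_apply, zpow_neg,
      Circle.coe_inv_eq_conj]
    rfl

lemma mem_laurentSubalgebra {f : Circle →ᵇ ℂ} (hf : f ∈ laurentSubalgebra) :
    f ∈ Submodule.span ℂ (range circleMonomial) := by
  have h : Subalgebra.toSubmodule (Algebra.adjoin ℂ (range circleMonomial)) =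
      Submodule.span ℂ (range circleMonomial) := by
    apply Algebra.adjoin_eq_span_of_subset
    refine Subset.trans ?_ Submodule.subset_span
    intro x hx
    refine Submonoid.closure_induction (fun _ => id) ⟨0, ?_⟩ ?_ hx
    · ext u; simp [circleMonomial_apply]
    · rintro - - - - ⟨m, rfl⟩ ⟨n, rfl⟩
      refine ⟨m + n, ?_⟩
      ext u
      simp [circleMonomial_apply, zpow_add]
  rw [← h]
  exact hf

/-- A probability measure on the circle is determined by its moments. -/
lemma eq_of_moments_eq {μ ν : Measure Circle} [IsProbabilityMeasure μ] [IsProbabilityMeasure ν]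
    (h : ∀ n : ℕ, n ≠ 0 → ∫ u : Circle, (u : ℂ) ^ n ∂μ = ∫ u : Circle, (u : ℂ) ^ n ∂ν) :
    μ = ν := by
  refine ext_of_forall_mem_subalgebra_integral_eq_of_pseudoEMetric_complete_countable
    (𝕜 := ℂ) (A := laurentSubalgebra) ?_ ?_
  · intro x y hxy
    refine ⟨circleMonomial 1, ⟨(circleMonomial 1).toContinuousMap,
      ⟨circleMonomial 1, Algebra.subset_adjoin ⟨1, rfl⟩, rfl⟩, rfl⟩, ?_⟩
    simpa [circleMonomial_apply, Circle.ext_iff] using hxy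
  · intro f hf
    have hnat : ∀ n : ℕ, ∫ u : Circle, (u : ℂ) ^ n ∂μ = ∫ u : Circle, (u : ℂ) ^ n ∂ν := by
      intro n
      rcases eq_or_ne n 0 with rfl | hn
      · simp
      · exact h n hn
    refine Submodule.span_induction (p := fun f _ => ∫ u, f u ∂μ = ∫ u, f u ∂ν) ?_ ?_ ?_ ?_
      (mem_laurentSubalgebra hf)
    · rintro - ⟨n, rfl⟩
      simp only [circleMonomial_apply]
      obtain ⟨n, rfl | rfl⟩ := n.eq_nat_or_neg
      · simpa using hnat n
      · have h1 := congrArg (starRingEnd ℂ) (hnat n)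
        rw [← integral_conj, ← integral_conj] at h1
        simpa only [zpow_neg, zpow_natCast, Circle.coe_inv_eq_conj, Circle.coe_pow] using h1
    · simp
    · intro f g _ _ hf hg
      simp only [BoundedContinuousFunction.add_apply]
      rw [integral_add (integrable_circle μ f.continuous) (integrable_circle μ g.continuous),
        integral_add (integrable_circle ν f.continuous) (integrable_circle ν g.continuous), hf, hg]
    · intro c f _ hf
      simp only [BoundedContinuousFunction.smul_apply]
      rw [integral_smul, integral_smul, hf]

/-- The coefficients of `ψ_μ` at the origin are the moments of `μ`. -/
lemma hasFPowerSeriesAt_psi (μ : Measure Circle) [IsProbabilityMeasure μ] :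
    HasFPowerSeriesAt (psi μ) (FormalMultilinearSeries.ofScalars ℂ
      fun n : ℕ => if n = 0 then 0 else ∫ u : Circle, (u : ℂ) ^ n ∂μ) 0 := by
  rw [hasFPowerSeriesAt_iff]
  filter_upwards [Metric.ball_mem_nhds (0 : ℂ) one_pos] with z hz
  have hz' : ‖z‖ < 1 := by simpa using hz
  simp only [FormalMultilinearSeries.coeff_ofScalars, zero_add]
  set F : ℕ → Circle → ℂ := fun n u => if n = 0 then 0 else ((u : ℂ) * z) ^ n
  have hcont : ∀ n, Continuous (F n) := by
    intro n
    simp only [F]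
    split_ifs
    · exact continuous_const
    · exact (continuous_coe_circle.mul continuous_const).pow n
  have hnorm : ∀ n u, ‖F n u‖ ≤ ‖z‖ ^ n := by
    intro n u
    simp only [F]
    split_ifs with h
    · simp
    · simp [Circle.norm_coe]
  have hs : Summable fun n => ∫ u, ‖F n u‖ ∂μ := by
    refine Summable.of_nonneg_of_le (fun n => integral_nonneg fun u => norm_nonneg _) (fun n => ?_)
      (summable_geometric_of_lt_one (norm_nonneg z) hz')
    refine (integral_mono (integrable_circle μ (hcont n).norm) (integrable_const _)
      (hnorm n)).trans ?_
    simp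
  have h1 := hasSum_integral_of_summable_integral_norm
    (fun n => integrable_circle μ (hcont n)) hs
  have h2 : ∀ u : Circle, ∑' n, F n u = (u : ℂ) * z / (1 - (u : ℂ) * z) := by
    intro u
    have hu : ‖(u : ℂ) * z‖ < 1 := by simpa [Circle.norm_coe] using hz'
    have hg := hasSum_geometric_of_norm_lt_one hu
    have : HasSum (fun n => F n u) ((1 - (u : ℂ) * z)⁻¹ - 1) := by
      have h3 := hg.sub (hasSum_ite_eq 0 (1 : ℂ))
      refine h3.congr_fun ?_
      intro n
      simp only [F]
      split_ifs with h
      · simp [h]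
      · simp
    rw [this.tsum_eq]
    have := one_sub_mul_ne_zero u hz'
    field_simp
    ring
  simp only [h2] at h1
  refine h1.congr_fun fun n => ?_
  simp only [F]
  split_ifs with h
  · simp
  · simp only [mul_pow, smul_eq_mul]
    rw [integral_mul_const, mul_comm]

lemma psi_zero (μ : Measure Circle) : psi μ 0 = 0 := by simp [psi]

lemma hasStrictDerivAt_psi (μ : Measure Circle) [IsProbabilityMeasure μ] :
    HasStrictDerivAt (psi μ) (∫ u : Circle, (u : ℂ) ∂μ) 0 := by
  have := (hasFPowerSeriesAt_psi μ).hasStrictDerivAt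
  simpa [FormalMultilinearSeries.ofScalars] using this

/-- The inverse function of `ψ` for the free unitary Poisson distribution. -/
noncomputable def chi (t : ℝ) (z : ℂ) : ℂ := z / (1 + z) * Complex.exp (t / (z + 1 / 2))

lemma analyticAt_chi (t : ℝ) : AnalyticAt ℂ (chi t) 0 := by
  refine (analyticAt_id.div (analyticAt_const.add analyticAt_id) (by simp)).mul ?_
  exact (analyticAt_const.div (analyticAt_id.add analyticAt_const) (by simp)).cexp'

lemma chi_zero : chi t 0 = 0 := by simp [chi]

lemma hasStrictDerivAt_chi (t : ℝ) : HasStrictDerivAt (chi t) (Complex.exp (2 * t)) 0 := by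
  have h1 := (analyticAt_chi t).hasStrictDerivAt
  have h2 : HasDerivAt (fun z : ℂ => z / (1 + z)) 1 0 := by
    refine ((hasDerivAt_id (0 : ℂ)).div ((hasDerivAt_id (0 : ℂ)).const_add 1)
      (by simp)).congr_deriv ?_
    simp
  have h3 : DifferentiableAt ℂ (fun z : ℂ => Complex.exp (t / (z + 1 / 2))) 0 :=
    ((differentiableAt_const _).div (by fun_prop) (by simp)).cexp
  have h4 := h2.mul h3.hasDerivAt
  have h5 : HasDerivAt (chi t) (Complex.exp (2 * t)) 0 := by
    refine h4.congr_deriv ?_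
    simp [mul_comm]
  rwa [h5.deriv] at h1

lemma eventuallyEq_chi {χ : ℂ → ℂ} (h0 : χ 0 = 0)
    (h : ∀ᶠ z in 𝓝[≠] (0 : ℂ), Complex.exp (t / (z + 1 / 2)) = (1 + z) / z * χ z) :
    χ =ᶠ[𝓝 0] chi t := by
  have h1 : ∀ᶠ z in 𝓝[≠] (0 : ℂ), χ z = chi t z := by
    have hne : ∀ᶠ z in 𝓝 (0 : ℂ), 1 + z ≠ 0 :=
      ContinuousAt.eventually_ne (by fun_prop) (by simp)
    filter_upwards [h, self_mem_nhdsWithin, mem_nhdsWithin_of_mem_nhds hne] with z hz hz0 hz1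
    have hz0' : z ≠ 0 := hz0
    rw [chi, hz]
    field_simp
  rw [eventually_nhdsWithin_iff] at h1
  filter_upwards [h1] with z hz
  rcases eq_or_ne z 0 with rfl | hne
  · rw [h0, chi_zero]
  · exact hz hne

lemma IsFreeUnitaryPoisson.unique {μ ν : Measure Circle} (hμ : IsFreeUnitaryPoisson t μ)
    (hν : IsFreeUnitaryPoisson t ν) : μ = ν := by
  obtain ⟨hμp, -, χ, ⟨-, hχ0, hχ, -⟩, hS⟩ := hμ
  obtain ⟨hνp, -, χ', ⟨-, hχ0', -, hχ'⟩, hS'⟩ := hν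
  have hc : Tendsto (psi ν) (𝓝 0) (𝓝 0) := by
    simpa [ContinuousAt, psi_zero] using (hasStrictDerivAt_psi ν).hasDerivAt.continuousAt
  have he : χ =ᶠ[𝓝 0] χ' := (eventuallyEq_chi hχ0 hS).trans (eventuallyEq_chi hχ0' hS').symm
  -- `ψ_μ = ψ_μ ∘ χ ∘ ψ_ν = ψ_ν`
  have key : psi μ =ᶠ[𝓝 0] psi ν := by
    filter_upwards [hχ', hc.eventually hχ, hc.eventually he] with z h1 h2 h3
    rw [h3, h1] at h2
    exact h2
  have hser := (hasFPowerSeriesAt_psi μ).eq_formalMultilinearSeries_of_eventually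
    (hasFPowerSeriesAt_psi ν) key
  apply eq_of_moments_eq
  intro n hn
  have := congrArg (fun p => FormalMultilinearSeries.coeff p n) hser
  simpa only [FormalMultilinearSeries.coeff_ofScalars, if_neg hn] using this

end FreePoisson

/-! ### Herglotz representation -/

namespace FreePoisson

open scoped BoundedContinuousFunction

instance isFiniteMeasure_lengthMeasure : IsFiniteMeasure lengthMeasure := by
  unfold lengthMeasure; infer_instance

lemma lengthMeasure_singleton_one : lengthMeasure {1} = 0 := by
  rw [lengthMeasure, Measure.map_apply Circle.exp.continuous.measurable (measurableSet_singleton 1)]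
  refine Measure.restrict_le_self.absolutelyContinuous (Set.Countable.measure_zero ?_ _)
  refine (countable_range (fun n : ℤ => (n : ℝ) * (2 * Real.pi))).mono ?_
  intro θ hθ
  have h1 : Circle.exp θ = 1 := hθ
  obtain ⟨n, hn⟩ := Circle.exp_eq_one.1 h1
  exact ⟨n, hn.symm⟩

lemma integral_lengthMeasure {g : ℂ → ℂ} (hg : Continuous fun u : Circle => g u) :
    ∫ u : Circle, g u ∂lengthMeasure = 2 * Real.pi * Real.circleAverage g 0 1 := by
  rw [lengthMeasure, integral_map Circle.exp.continuous.aemeasurable hg.aestronglyMeasurable,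
    ← intervalIntegral.integral_of_le (by linarith [Real.pi_pos]), Real.circleAverage]
  have hper : Function.Periodic (fun θ : ℝ => g (Circle.exp θ)) (2 * Real.pi) := fun θ => by
    simp only [Circle.exp_add, Circle.exp_two_pi, mul_one]
  have h1 := hper.intervalIntegral_add_eq (-Real.pi) 0
  rw [show -Real.pi + 2 * Real.pi = Real.pi by ring, zero_add] at h1
  rw [h1, Complex.real_smul]
  simp only [circleMap, Circle.coe_exp, Complex.ofReal_one, one_mul, zero_add]
  have := Real.pi_pos.ne'
  push_cast
  rw [← mul_assoc, mul_inv_cancel₀ (by simp [this]), one_mul]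

lemma circle_conj (u : Circle) : (starRingEnd ℂ) (u : ℂ) = (u : ℂ)⁻¹ := by
  rw [← Circle.coe_inv_eq_conj, Circle.coe_inv]

lemma coe_circle_mem_closedBall (u : Circle) : (u : ℂ) ∈ Metric.closedBall (0 : ℂ) 1 := by
  simp [Circle.norm_coe]

/-- The kernel `(1 + u z) / (1 - u z)` is holomorphic in `u`, so integrating it against a
holomorphic function only sees the centre; integrating it against the conjugate of a holomorphic
function gives a Cauchy integral. Together this is the Schwarz formula. -/
lemma schwarz_formula {g : ℂ → ℂ} (hg : DiffContOnCl ℂ g (Metric.ball 0 1)) (h0 : g 0 = 1)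
    {z : ℂ} (hz : ‖z‖ < 1) :
    ∫ u : Circle, ((g u).re : ℂ) * ((1 + u * z) / (1 - u * z)) ∂lengthMeasure =
      2 * Real.pi * (starRingEnd ℂ) (g ((starRingEnd ℂ) z)) := by
  set w := (starRingEnd ℂ) z with hw
  have hwn : ‖w‖ < 1 := by rwa [hw, RCLike.norm_conj]
  have hgc : ContinuousOn g (Metric.closedBall 0 1) := by
    have := hg.continuousOn
    rwa [closure_ball _ one_ne_zero] at this
  have hgu : Continuous fun u : Circle => g u :=
    hgc.comp_continuous continuous_coe_circle coe_circle_mem_closedBall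
  have hk1 : Continuous fun u : Circle => (1 + (u : ℂ) * z) / (1 - u * z) :=
    Continuous.div (by fun_prop) (by fun_prop) fun u => one_sub_mul_ne_zero u hz
  have hne : ∀ u : Circle, (u : ℂ) - w ≠ 0 := by
    intro u h
    have := congrArg norm (sub_eq_zero.1 h)
    rw [Circle.norm_coe] at this
    linarith
  have hk2 : Continuous fun u : Circle => ((u : ℂ) - 0) / (u - w) :=
    Continuous.div (by fun_prop) (by fun_prop) hne
  -- mean value property: `g` times the kernel is holomorphic in `u`
  have h1 : ∫ u : Circle, (1 + (u : ℂ) * z) / (1 - u * z) * g u ∂lengthMeasure =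
      2 * Real.pi := by
    rw [integral_lengthMeasure (g := fun u => (1 + u * z) / (1 - u * z) * g u) (hk1.mul hgu)]
    have hkd : DifferentiableOn ℂ (fun u : ℂ => (1 + u * z) / (1 - u * z))
        (Metric.closedBall 0 1) := by
      refine DifferentiableOn.div (by fun_prop) (by fun_prop) fun u hu h => ?_
      have h2 : ‖u * z‖ = 1 := by rw [← sub_eq_zero.1 h, norm_one]
      have h3 : ‖u‖ ≤ 1 := by simpa using hu
      rw [norm_mul] at h2
      nlinarith [norm_nonneg u, norm_nonneg z]
    have hd : DiffContOnCl ℂ (fun u : ℂ => (1 + u * z) / (1 - u * z) * g u)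
        (Metric.ball 0 1) := by
      have hk : DiffContOnCl ℂ (fun u : ℂ => (1 + u * z) / (1 - u * z)) (Metric.ball 0 1) := by
        apply DifferentiableOn.diffContOnCl
        rw [closure_ball _ one_ne_zero]
        exact hkd
      exact hk.smul hg
    rw [DiffContOnCl.circleAverage (by simpa using hd)]
    simp [h0]
  -- Cauchy's formula at `w`, since the conjugate of the kernel is `2 u / (u - w) - 1` on the circle
  have h2 : ∫ u : Circle, ((u : ℂ) - 0) / (u - w) * g u ∂lengthMeasure =
      2 * Real.pi * g w := by
    rw [integral_lengthMeasure (g := fun u => (u - 0) / (u - w) * g u) (hk2.mul hgu)]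
    congr 1
    exact DiffContOnCl.circleAverage_smul_div (by simpa using hg) (by simpa using hwn)
  have h3 : ∫ u : Circle, g u ∂lengthMeasure = 2 * Real.pi := by
    rw [integral_lengthMeasure hgu, DiffContOnCl.circleAverage (by simpa using hg), h0, mul_one]
  have h4 : ∀ u : Circle, ((g u).re : ℂ) * ((1 + u * z) / (1 - u * z)) =
      (1 / 2) * ((1 + (u : ℂ) * z) / (1 - u * z) * g u) +
      ((starRingEnd ℂ) (((u : ℂ) - 0) / (u - w) * g u) - (1 / 2) * (starRingEnd ℂ) (g u)) := by
    intro u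
    have hu1 := one_sub_mul_ne_zero u hz
    have hu2 : (u : ℂ)⁻¹ - z ≠ 0 := by
      have := hne u
      rw [← map_ne_zero (starRingEnd ℂ), map_sub, circle_conj, hw, Complex.conj_conj] at this
      exact this
    have hk : (u : ℂ)⁻¹ / ((u : ℂ)⁻¹ - z) = 1 / (1 - u * z) := by
      rw [div_eq_div_iff hu2 hu1]; field_simp
    rw [Complex.re_eq_add_conj, map_mul, map_div₀, map_sub, map_sub, circle_conj, hw,
      Complex.conj_conj, map_zero, sub_zero, hk]
    field_simp
    ring
  have hconj : Continuous (starRingEnd ℂ) := Complex.continuous_conj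
  simp only [h4]
  rw [integral_add, integral_sub, integral_const_mul, integral_const_mul, h1, integral_conj,
    integral_conj, h2, h3]
  · simp only [map_mul, map_ofNat, Complex.conj_ofReal]
    ring
  · exact integrable_circle _ (hconj.comp (hk2.mul hgu))
  · exact integrable_circle _ (continuous_const.mul (hconj.comp hgu))
  · exact integrable_circle _ (continuous_const.mul (hk1.mul hgu))
  · exact integrable_circle _ ((hconj.comp (hk2.mul hgu)).sub
      (continuous_const.mul (hconj.comp hgu)))

/-- Herglotz representation: a holomorphic function on the disk with nonnegative real part, real on
the real axis and equal to `1` at `0`, is the Herglotz transform of a probability measure, which is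
a limit of the measures with densities `Re h (ρ u) / (2 π)` along radii `ρ → 1`. -/
lemma exists_herglotz_measure {h : ℂ → ℂ} (hd : DifferentiableOn ℂ h (Metric.ball 0 1))
    (h0 : h 0 = 1) (hpos : ∀ z ∈ Metric.ball (0 : ℂ) 1, 0 ≤ (h z).re)
    (hconj : ∀ z ∈ Metric.ball (0 : ℂ) 1, h ((starRingEnd ℂ) z) = (starRingEnd ℂ) (h z))
    {ρ : ℕ → ℝ} (hρ0 : ∀ n, 0 ≤ ρ n) (hρ1 : ∀ n, ρ n < 1) (hρ : Tendsto ρ atTop (𝓝 1)) :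
    ∃ P : Measure Circle, IsProbabilityMeasure P ∧
      (∀ z : ℂ, ‖z‖ < 1 → ∫ u : Circle, (1 + (u : ℂ) * z) / (1 - u * z) ∂P = h z) ∧
      ∃ F : Filter ℕ, F.NeBot ∧ F ≤ atTop ∧ ∀ f : Circle →ᵇ ℝ,
        Tendsto (fun n => ∫ u : Circle, (1 / (2 * Real.pi) * (h (ρ n * u)).re) * f u
          ∂lengthMeasure) F (𝓝 (∫ u, f u ∂P)) := by
  have hmem : ∀ n (z : ℂ), ‖z‖ ≤ 1 → (ρ n : ℂ) * z ∈ Metric.ball (0 : ℂ) 1 := by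
    intro n z hz
    simp only [Metric.mem_ball, dist_zero_right, norm_mul, Complex.norm_real,
      Real.norm_of_nonneg (hρ0 n)]
    nlinarith [hρ0 n, hρ1 n, norm_nonneg z]
  have hdiff : ∀ n, DiffContOnCl ℂ (fun z => h (ρ n * z)) (Metric.ball 0 1) := by
    intro n
    apply DifferentiableOn.diffContOnCl
    rw [closure_ball _ one_ne_zero]
    exact hd.comp (by fun_prop) fun z hz => hmem n z (by simpa using hz)
  have hcont : ∀ n, Continuous fun u : Circle => h (ρ n * u) := by
    intro n
    exact hd.continuousOn.comp_continuous (by fun_prop) fun u => hmem n u (Circle.norm_coe u).le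
  set d : ℕ → Circle → ℝ := fun n u => 1 / (2 * Real.pi) * (h (ρ n * u)).re
  have hdc : ∀ n, Continuous (d n) := fun n =>
    continuous_const.mul (Complex.continuous_re.comp (hcont n))
  have hd0 : ∀ n u, 0 ≤ d n u := fun n u =>
    mul_nonneg (by positivity) (hpos _ (hmem n u (Circle.norm_coe u).le))
  have hS : ∀ n (z : ℂ), ‖z‖ < 1 →
      ∫ u : Circle, (d n u : ℂ) * ((1 + u * z) / (1 - u * z)) ∂lengthMeasure = h (ρ n * z) := by
    intro n z hz
    have h1 := schwarz_formula (hdiff n) (by simp [h0]) hz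
    have h2 : (ρ n : ℂ) * (starRingEnd ℂ) z = (starRingEnd ℂ) (ρ n * z) := by simp
    rw [h2, hconj _ (hmem n z hz.le), Complex.conj_conj] at h1
    simp only [d]
    push_cast
    simp only [mul_assoc]
    rw [integral_const_mul, h1]
    field_simp
  have hint : ∀ n, ∫ u, d n u ∂lengthMeasure = 1 := by
    intro n
    have h1 := hS n 0 (by simp)
    simp only [mul_zero, add_zero, sub_zero, div_one, mul_one, h0] at h1
    have h2 : ((∫ u, d n u ∂lengthMeasure : ℝ) : ℂ) = 1 := integral_ofReal.symm.trans h1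
    exact_mod_cast h2
  have hprob : ∀ n, IsProbabilityMeasure
      (lengthMeasure.withDensity fun u => ENNReal.ofReal (d n u)) := by
    intro n
    refine ⟨?_⟩
    rw [withDensity_apply _ MeasurableSet.univ, Measure.restrict_univ,
      ← ofReal_integral_eq_lintegral_ofReal (integrable_circle _ (hdc n)) (.of_forall (hd0 n)),
      hint, ENNReal.ofReal_one]
  -- the probability measures on the compact circle form a compact space; a limit along an
  -- ultrafilter replaces the choice of a subsequence
  set μ : ℕ → ProbabilityMeasure Circle := fun n => ⟨_, hprob n⟩
  obtain ⟨P, -, hP⟩ := isCompact_univ.ultrafilter_le_nhds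
    ((hyperfilter ℕ).map μ) (by simp)
  have hT : Tendsto μ (hyperfilter ℕ : Filter ℕ) (𝓝 P) := hP
  have hle : (hyperfilter ℕ : Filter ℕ) ≤ atTop := by
    rw [← Nat.cofinite_eq_atTop]; exact hyperfilter_le_cofinite
  have hdens : ∀ {E : Type} [NormedAddCommGroup E] [NormedSpace ℝ E] (n : ℕ) (f : Circle → E),
      ∫ u, f u ∂(μ n : Measure Circle) = ∫ u, d n u • f u ∂lengthMeasure := by
    intro E _ _ n f
    have := integral_withDensity_eq_integral_toReal_smul (μ := lengthMeasure)
      (f := fun u => ENNReal.ofReal (d n u)) (hdc n).measurable.ennreal_ofReal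
      (.of_forall fun u => ENNReal.ofReal_lt_top) f
    simp only [ENNReal.toReal_ofReal (hd0 n _)] at this
    exact this
  refine ⟨P, inferInstance, ?_, (hyperfilter ℕ : Filter ℕ), inferInstance, hle, ?_⟩
  · intro z hz
    have hk : Continuous fun u : Circle => (1 + (u : ℂ) * z) / (1 - u * z) :=
      Continuous.div (by fun_prop) (by fun_prop) fun u => one_sub_mul_ne_zero u hz
    have h1 := (ProbabilityMeasure.tendsto_iff_forall_integral_rclike_tendsto ℂ).1 hT
      (BoundedContinuousFunction.mkOfCompact ⟨_, hk⟩)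
    simp only [BoundedContinuousFunction.mkOfCompact_apply, ContinuousMap.coe_mk] at h1
    simp only [hdens, Complex.real_smul, hS _ z hz] at h1
    have h2 : Tendsto (fun n => h (ρ n * z)) (hyperfilter ℕ : Filter ℕ) (𝓝 (h z)) := by
      have h3 : ContinuousAt h z :=
        (hd.differentiableAt (Metric.isOpen_ball.mem_nhds (by simpa using hz))).continuousAt
      refine h3.tendsto.comp ?_
      have h4 : Tendsto (fun n => (ρ n : ℂ) * z) atTop (𝓝 ((1 : ℝ) * z)) :=
        ((Complex.continuous_ofReal.tendsto 1).comp hρ).mul_const z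
      rw [Complex.ofReal_one, one_mul] at h4
      exact h4.mono_left hle
    exact tendsto_nhds_unique h1 h2
  · intro f
    have h1 := ProbabilityMeasure.tendsto_iff_forall_integral_tendsto.1 hT f
    simpa only [hdens, smul_eq_mul] using h1

end FreePoisson

/-! ### Existence, the atom and the absolutely continuous part -/

namespace FreePoisson

open scoped BoundedContinuousFunction

variable {t : ℝ}

lemma r_one_of_le (ht : 0 < t) (h : t ≤ 1) : r t 1 = 0 := by
  have h1 : zeta t 0 = 0 := by
    apply zeta_eq ht
    · refine ⟨by simp, ?_⟩
      simpa [shc_zero] using h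
    · simp [tanMap]
  have h2 := r_exp ht (θ := 0) (by simp)
  rwa [mul_zero, Complex.exp_zero, h1, Complex.tan_zero, mul_zero] at h2

lemma r_ne_zero_of_one_lt (h : 1 < t) {z : ℂ} (hz : ‖z‖ ≤ 1) : r t z ≠ 0 := by
  have ht : 0 < t := one_pos.trans h
  rcases eq_or_ne z 0 with rfl | h0
  · simp [r_zero]
  obtain ⟨θ, hθ, rfl⟩ := exists_exp_eq h0 hz
  have hreg := zeta_mem_region ht hθ
  rw [r_exp ht hθ]
  refine mul_ne_zero (by simp) fun htan => ?_
  rw [Complex.tan, div_eq_zero_iff, or_iff_left (cos_ne_zero ht hreg)] at htan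
  have h1 := normSq_sin (zeta t θ)
  rw [htan, map_zero] at h1
  have h2 := le_normSq_cos ht hreg
  rw [normSq_cos] at h2
  nlinarith [Real.sin_sq_add_cos_sq (zeta t θ).re, sq_nonneg (Real.sin (zeta t θ).re),
    sq_nonneg (Real.sinh (zeta t θ).im)]

/-- With `z = (1 - r) / (1 + r) exp (2 t r)`, the function `r ↦ (1 - z) / r`, extended by continuity
to `r = 0`. -/
noncomputable def edgeQuotient (t : ℝ) (w : ℂ) : ℂ :=
  dslope (fun w : ℂ => (1 + w) - (1 - w) * Complex.exp (2 * t * w)) 0 w / (1 + w)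

lemma hasDerivAt_edge (t : ℝ) : HasDerivAt
    (fun w : ℂ => (1 + w) - (1 - w) * Complex.exp (2 * t * w)) (2 - 2 * t) 0 := by
  have h1 : HasDerivAt (fun w : ℂ => Complex.exp (2 * t * w)) (2 * t) 0 := by
    have := ((hasDerivAt_id (0 : ℂ)).const_mul (2 * t : ℂ)).cexp
    simpa using this
  have h2 := ((hasDerivAt_id (0 : ℂ)).const_add 1).sub
    (((hasDerivAt_id (0 : ℂ)).const_sub 1).mul h1)
  refine h2.congr_deriv ?_
  simp
  ring

lemma edgeQuotient_zero (t : ℝ) : edgeQuotient t 0 = 2 - 2 * t := by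
  simp [edgeQuotient, (hasDerivAt_edge t).deriv]

lemma continuousAt_edgeQuotient {w : ℂ} (hw : 1 + w ≠ 0) : ContinuousAt (edgeQuotient t) w := by
  have h : Continuous (dslope (fun w : ℂ => (1 + w) - (1 - w) * Complex.exp (2 * t * w)) 0) := by
    rw [← continuousOn_univ, continuousOn_dslope Filter.univ_mem]
    exact ⟨by fun_prop, (hasDerivAt_edge t).differentiableAt⟩
  exact h.continuousAt.div (by fun_prop) hw

lemma mul_edgeQuotient (ht : 0 < t) {z : ℂ} (hz : ‖z‖ ≤ 1) :
    r t z * edgeQuotient t (r t z) = 1 - z := by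
  have h1 := sub_smul_dslope (fun w : ℂ => (1 + w) - (1 - w) * Complex.exp (2 * t * w)) 0 (r t z)
  simp only [sub_zero, smul_eq_mul, add_zero, mul_zero, Complex.exp_zero, mul_one, sub_self] at h1
  have h2 := one_add_r_ne_zero ht hz
  rw [edgeQuotient, ← mul_div_assoc, h1]
  conv_rhs => rw [← r_equation ht hz]
  field_simp

/-- The function `(1 - z) / r_t(z)` is continuous up to the unit circle. -/
lemma continuousOn_edgeQuotient_r (ht : 0 < t) :
    ContinuousOn (fun z => edgeQuotient t (r t z)) (Metric.closedBall 0 1) := fun z hz =>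
  (continuousAt_edgeQuotient (one_add_r_ne_zero ht (by simpa using hz))).comp_continuousWithinAt
    (continuousOn_r ht z hz)

lemma edgeQuotient_r_one (ht : 0 < t) : edgeQuotient t (r t 1) = 2 * (max (1 - t) 0 : ℝ) := by
  rcases le_or_gt t 1 with h | h
  · rw [r_one_of_le ht h, edgeQuotient_zero, max_eq_left (by linarith)]
    push_cast; ring
  · have h1 := mul_edgeQuotient ht (z := 1) (by simp)
    rw [sub_self, mul_eq_zero, or_iff_right (r_ne_zero_of_one_lt h (by simp))] at h1
    rw [h1, max_eq_right (by linarith)]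
    simp

lemma one_sub_mul_inv_r (ht : 0 < t) {z : ℂ} (hz : ‖z‖ ≤ 1) (h1 : z ≠ 1) :
    (1 - z) * (1 / r t z) = edgeQuotient t (r t z) := by
  rw [← mul_edgeQuotient ht hz]
  have := r_ne_zero ht hz h1
  field_simp

/-- The mass of the atom at `1` is the limit of the Herglotz transform multiplied by
`(1 - s) / (1 + s)`. -/
lemma tendsto_atom (P : Measure Circle) [IsProbabilityMeasure P] {ρ : ℕ → ℝ}
    (hρ0 : ∀ n, 0 ≤ ρ n) (hρ1 : ∀ n, ρ n < 1) (hρ : Tendsto ρ atTop (𝓝 1)) :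
    Tendsto (fun n => ((1 - ρ n) / (1 + ρ n) : ℂ) *
      ∫ u : Circle, (1 + (u : ℂ) * ρ n) / (1 - u * ρ n) ∂P) atTop (𝓝 (P.real {1} : ℂ)) := by
  have hnorm : ∀ n, ‖(ρ n : ℂ)‖ = ρ n := fun n => by
    rw [Complex.norm_real, Real.norm_of_nonneg (hρ0 n)]
  have hlt : ∀ n, ‖(ρ n : ℂ)‖ < 1 := fun n => by rw [hnorm]; exact hρ1 n
  have hρc : Tendsto (fun n => (ρ n : ℂ)) atTop (𝓝 1) := by
    rw [← Complex.ofReal_one]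
    exact (Complex.continuous_ofReal.tendsto 1).comp hρ
  have hlim : (P.real {1} : ℂ) = ∫ u : Circle, ({1} : Set Circle).indicator (fun _ => (1 : ℂ)) u
      ∂P := by
    rw [integral_indicator (measurableSet_singleton 1)]
    simp [measureReal_def]
  rw [hlim]
  simp only [← integral_const_mul]
  refine tendsto_integral_of_dominated_convergence (fun _ => 1) ?_ (integrable_const _) ?_ ?_
  · intro n
    refine Continuous.aestronglyMeasurable (continuous_const.mul ?_)
    exact Continuous.div (by fun_prop) (by fun_prop) fun u => one_sub_mul_ne_zero u (hlt n)
  · intro n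
    refine .of_forall fun u => ?_
    have h1 : ‖1 + (u : ℂ) * ρ n‖ ≤ 1 + ρ n := by
      refine (norm_add_le _ _).trans ?_
      rw [norm_mul, Circle.norm_coe, hnorm, norm_one, one_mul]
    have h2 : 1 - ρ n ≤ ‖1 - (u : ℂ) * ρ n‖ := by
      have := norm_sub_norm_le (1 : ℂ) ((u : ℂ) * ρ n)
      rwa [norm_mul, Circle.norm_coe, hnorm, norm_one, one_mul] at this
    have h3 : ‖(1 - ρ n : ℂ)‖ = 1 - ρ n := by
      rw [← Complex.ofReal_one, ← Complex.ofReal_sub, Complex.norm_real, Real.norm_of_nonneg]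
      linarith [hρ1 n]
    have h4 : ‖(1 + ρ n : ℂ)‖ = 1 + ρ n := by
      rw [← Complex.ofReal_one, ← Complex.ofReal_add, Complex.norm_real, Real.norm_of_nonneg]
      linarith [hρ0 n]
    have h5 : 0 < 1 - ρ n := by linarith [hρ1 n]
    have h6 : 0 < 1 + ρ n := by linarith [hρ0 n]
    rw [norm_mul, norm_div, norm_div, h3, h4, div_mul_div_comm]
    rw [div_le_one (mul_pos h6 (h5.trans_le h2)), mul_comm]
    exact mul_le_mul h1 h2 h5.le h6.le
  · refine .of_forall fun u => ?_
    rcases eq_or_ne u 1 with rfl | hu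
    · rw [indicator_of_mem (mem_singleton _)]
      refine tendsto_const_nhds.congr fun n => ?_
      have h5 : (1 - ρ n : ℂ) ≠ 0 := by
        exact_mod_cast (by linarith [hρ1 n] : (0 : ℝ) < 1 - ρ n).ne'
      have h6 : (1 + ρ n : ℂ) ≠ 0 := by
        exact_mod_cast (by linarith [hρ0 n] : (0 : ℝ) < 1 + ρ n).ne'
      rw [Circle.coe_one, one_mul]
      field_simp
    · rw [indicator_of_notMem (by simpa using hu)]
      have hu' : 1 - (u : ℂ) * 1 ≠ 0 := by
        rw [mul_one, sub_ne_zero]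
        exact fun h => hu (Circle.coe_eq_one.1 h.symm)
      have h1 : ContinuousAt (fun s : ℂ => (1 - s) / (1 + s) *
          ((1 + (u : ℂ) * s) / (1 - u * s))) 1 := by
        refine ContinuousAt.mul (ContinuousAt.div (by fun_prop) (by fun_prop) (by norm_num))
          (ContinuousAt.div (by fun_prop) (by fun_prop) hu')
      have h2 := h1.tendsto.comp hρc
      rw [sub_self, zero_div, zero_mul] at h2
      exact h2

/-- The finite density `(1 / 2π) Re (1 / r_t)`; at a zero of `r_t` it takes the junk value `0`. -/
noncomputable def realDensity (t : ℝ) (u : Circle) : ℝ := 1 / (2 * Real.pi) * (1 / r t u).re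

lemma realDensity_nonneg (ht : 0 < t) (u : Circle) : 0 ≤ realDensity t u := by
  refine mul_nonneg (by positivity) ?_
  rw [one_div, Complex.inv_re]
  exact div_nonneg (re_r_nonneg ht (Circle.norm_coe u).le) (Complex.normSq_nonneg _)

lemma continuous_r_circle (ht : 0 < t) : Continuous fun u : Circle => r t u :=
  (continuousOn_r ht).comp_continuous continuous_coe_circle coe_circle_mem_closedBall

lemma measurable_realDensity (ht : 0 < t) : Measurable (realDensity t) := by
  refine measurable_const.mul (Complex.measurable_re.comp ?_)
  exact measurable_const.div (continuous_r_circle ht).measurable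

lemma ae_ne_one : ∀ᵐ u ∂lengthMeasure, u ≠ (1 : Circle) := by
  rw [ae_iff]
  simpa using lengthMeasure_singleton_one

lemma density_ae_eq : density t =ᵐ[lengthMeasure] fun u => ENNReal.ofReal (realDensity t u) := by
  filter_upwards [ae_ne_one] with u hu
  rw [density, if_neg fun h => hu h.2, realDensity]

/-- Boundary values of the Herglotz transform give the density away from the point `1`: the bounded
function `‖1 - u‖` compensates the singularity of `1 / r_t` at `1`, so that dominated convergence
applies. -/
lemma integral_weight_eq (ht : 0 < t) {P : Measure Circle} {ρ : ℕ → ℝ} {F : Filter ℕ} [F.NeBot]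
    (hF : F ≤ atTop) (hρ0 : ∀ n, 0 ≤ ρ n) (hρ1 : ∀ n, ρ n < 1) (hρ : Tendsto ρ atTop (𝓝 1))
    (hP : ∀ f : Circle →ᵇ ℝ, Tendsto (fun n => ∫ u : Circle,
      (1 / (2 * Real.pi) * (1 / r t (ρ n * u)).re) * f u ∂lengthMeasure) F (𝓝 (∫ u, f u ∂P)))
    (f : Circle →ᵇ ℝ) :
    ∫ u, ‖(1 : ℂ) - u‖ * f u ∂P =
      ∫ u, realDensity t u * (‖(1 : ℂ) - u‖ * f u) ∂lengthMeasure := by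
  have hw : Continuous fun u : Circle => ‖(1 : ℂ) - u‖ * f u :=
    (by fun_prop : Continuous fun u : Circle => ‖(1 : ℂ) - u‖).mul f.continuous
  have h1 := hP (BoundedContinuousFunction.mkOfCompact ⟨_, hw⟩)
  simp only [BoundedContinuousFunction.mkOfCompact_apply, ContinuousMap.coe_mk] at h1
  refine tendsto_nhds_unique h1 (Tendsto.mono_left ?_ hF)
  obtain ⟨M, hM⟩ := (isCompact_closedBall (0 : ℂ) 1).exists_bound_of_continuousOn
    (continuousOn_edgeQuotient_r ht)
  have hnorm : ∀ n (u : Circle), ‖(ρ n : ℂ) * u‖ = ρ n := fun n u => by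
    rw [norm_mul, Circle.norm_coe, mul_one, Complex.norm_real, Real.norm_of_nonneg (hρ0 n)]
  have hmem : ∀ n (u : Circle), (ρ n : ℂ) * u ∈ Metric.closedBall (0 : ℂ) 1 := fun n u => by
    simpa only [Metric.mem_closedBall, dist_zero_right, hnorm] using (hρ1 n).le
  have hne : ∀ n (u : Circle), (ρ n : ℂ) * u ≠ 1 := fun n u h => by
    have := hnorm n u
    rw [h, norm_one] at this
    linarith [hρ1 n]
  refine tendsto_integral_of_dominated_convergence
    (fun u => 1 / (2 * Real.pi) * (2 * M) * ‖f u‖) ?_ ?_ ?_ ?_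
  · intro n
    refine Continuous.aestronglyMeasurable (Continuous.mul (continuous_const.mul
      (Complex.continuous_re.comp (continuous_const.div ?_ ?_))) hw)
    · exact (continuousOn_r ht).comp_continuous (by fun_prop) (hmem n)
    · exact fun u => r_ne_zero ht (by simpa using hmem n u) (hne n u)
  · exact integrable_circle _ (continuous_const.mul f.continuous.norm)
  · intro n
    refine .of_forall fun u => ?_
    -- because `‖ρ u - u‖ = 1 - ρ ≤ ‖1 - ρ u‖`
    have h2 : ‖(1 : ℂ) - u‖ ≤ 2 * ‖1 - (ρ n : ℂ) * u‖ := by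
      have h3 : ‖(1 : ℂ) - u‖ ≤ ‖1 - (ρ n : ℂ) * u‖ + (1 - ρ n) := by
        have h4 : (1 : ℂ) - u = (1 - (ρ n : ℂ) * u) + (((ρ n - 1 : ℝ) : ℂ) * u) := by
          push_cast; ring
        refine (congrArg norm h4).le.trans ((norm_add_le _ _).trans ?_)
        rw [norm_mul, Circle.norm_coe, mul_one, Complex.norm_real, Real.norm_of_nonpos]
        · linarith
        · linarith [hρ1 n]
      have h5 := norm_sub_norm_le (1 : ℂ) ((ρ n : ℂ) * u)
      rw [norm_one, hnorm] at h5
      linarith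
    have h6 : ‖1 - (ρ n : ℂ) * u‖ * ‖1 / r t (ρ n * u)‖ ≤ M := by
      rw [← norm_mul, one_sub_mul_inv_r ht (by simpa using hmem n u) (hne n u)]
      exact hM _ (hmem n u)
    have h7 := Complex.abs_re_le_norm (1 / r t (ρ n * u))
    rw [norm_mul, norm_mul, norm_mul, norm_norm, Real.norm_of_nonneg (by positivity :
      (0 : ℝ) ≤ 1 / (2 * Real.pi)), mul_assoc, mul_assoc, ← mul_assoc ‖(1 / r t (ρ n * u)).re‖]
    refine mul_le_mul_of_nonneg_left (mul_le_mul_of_nonneg_right ?_ (norm_nonneg _))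
      (by positivity)
    calc ‖(1 / r t (ρ n * u)).re‖ * ‖(1 : ℂ) - u‖
        ≤ ‖1 / r t (ρ n * u)‖ * (2 * ‖1 - (ρ n : ℂ) * u‖) :=
          mul_le_mul h7 h2 (norm_nonneg _) (norm_nonneg _)
      _ ≤ 2 * M := by linarith
  · filter_upwards [ae_ne_one] with u hu
    have hu1 : (u : ℂ) ≠ 1 := fun h => hu (Circle.coe_eq_one.1 h)
    have hl : Tendsto (fun n => (ρ n : ℂ) * u) atTop (𝓝[Metric.closedBall 0 1] u) := by
      refine tendsto_nhdsWithin_iff.2 ⟨?_, .of_forall fun n => hmem n u⟩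
      have := ((Complex.continuous_ofReal.tendsto 1).comp hρ).mul_const (u : ℂ)
      simpa using this
    have h2 := (continuousOn_r ht u (coe_circle_mem_closedBall u)).tendsto.comp hl
    have h3 : Tendsto (fun n => 1 / r t (ρ n * u)) atTop (𝓝 (1 / r t u)) :=
      tendsto_const_nhds.div h2 (r_ne_zero ht (Circle.norm_coe u).le hu1)
    exact (((Complex.continuous_re.tendsto _).comp h3).const_mul _).mul_const _

/-- Two measures that agree when multiplied by the weight `‖1 - u‖` agree off the zero `u = 1` of
the weight. -/
lemma restrict_compl_eq (ht : 0 < t) {P : Measure Circle} [IsProbabilityMeasure P]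
    (hP : ∀ f : Circle →ᵇ ℝ, ∫ u, ‖(1 : ℂ) - u‖ * f u ∂P =
      ∫ u, realDensity t u * (‖(1 : ℂ) - u‖ * f u) ∂lengthMeasure) :
    P.restrict {1}ᶜ = lengthMeasure.withDensity (density t) := by
  have hwc : Continuous fun u : Circle => ‖(1 : ℂ) - u‖ := by fun_prop
  set w : Circle → ℝ≥0∞ := fun u => ENNReal.ofReal ‖(1 : ℂ) - u‖
  have hw : Measurable w := hwc.measurable.ennreal_ofReal
  set d : Circle → ℝ≥0∞ := fun u => ENNReal.ofReal (realDensity t u)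
  have hd : Measurable d := (measurable_realDensity ht).ennreal_ofReal
  have hdw : ∀ u, d u * w u = ENNReal.ofReal (realDensity t u * ‖(1 : ℂ) - u‖) := fun u =>
    (ENNReal.ofReal_mul (realDensity_nonneg ht u)).symm
  have hbound : ∀ u, realDensity t u * ‖(1 : ℂ) - u‖ = 1 / (2 * Real.pi) *
      ((1 / r t u).re * ‖(1 : ℂ) - u‖) := fun u => by rw [realDensity]; ring
  obtain ⟨M, hM⟩ := (isCompact_closedBall (0 : ℂ) 1).exists_bound_of_continuousOn
    (continuousOn_edgeQuotient_r ht)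
  have hM0 : 0 ≤ M := (norm_nonneg _).trans (hM 0 (by simp))
  have hle : ∀ u : Circle, d u * w u ≤ ENNReal.ofReal (1 / (2 * Real.pi) * M) := by
    intro u
    rw [hdw, hbound]
    refine ENNReal.ofReal_le_ofReal (mul_le_mul_of_nonneg_left ?_ (by positivity))
    rcases eq_or_ne u 1 with rfl | hu
    · simpa using hM0
    · have hu1 : (u : ℂ) ≠ 1 := fun h => hu (Circle.coe_eq_one.1 h)
      have h1 := hM u (coe_circle_mem_closedBall u)
      rw [← one_sub_mul_inv_r ht (Circle.norm_coe u).le hu1, norm_mul] at h1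
      have h2 := Complex.re_le_norm (1 / r t u)
      nlinarith [norm_nonneg ((1 : ℂ) - u)]
  have hfin1 : IsFiniteMeasure (P.withDensity w) := by
    refine isFiniteMeasure_withDensity ?_
    have h2 : ∫⁻ u, w u ∂P ≤ ∫⁻ _, ENNReal.ofReal 2 ∂P := by
      refine lintegral_mono fun u => ENNReal.ofReal_le_ofReal ?_
      refine (norm_sub_le _ _).trans ?_
      rw [norm_one, Circle.norm_coe]
      norm_num
    refine (h2.trans_lt ?_).ne
    simp
  have hfin2 : IsFiniteMeasure (lengthMeasure.withDensity (d * w)) := by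
    refine isFiniteMeasure_withDensity ?_
    have h2 : ∫⁻ u, (d * w) u ∂lengthMeasure ≤
        ∫⁻ _, ENNReal.ofReal (1 / (2 * Real.pi) * M) ∂lengthMeasure := lintegral_mono hle
    refine (h2.trans_lt ?_).ne
    rw [lintegral_const]
    exact ENNReal.mul_lt_top ENNReal.ofReal_lt_top (measure_lt_top _ _)
  have heq : P.withDensity w = lengthMeasure.withDensity (d * w) := by
    refine ext_of_forall_integral_eq_of_IsFiniteMeasure fun f => ?_
    rw [integral_withDensity_eq_integral_toReal_smul hw
      (.of_forall fun u => ENNReal.ofReal_lt_top),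
      integral_withDensity_eq_integral_toReal_smul (hd.mul hw)
      (.of_forall fun u => ENNReal.mul_lt_top ENNReal.ofReal_lt_top ENNReal.ofReal_lt_top)]
    simp only [Pi.mul_apply, hdw, smul_eq_mul, w, ENNReal.toReal_ofReal (norm_nonneg _),
      ENNReal.toReal_ofReal (mul_nonneg (realDensity_nonneg ht _) (norm_nonneg _)), mul_assoc]
    exact hP f
  have hw0 : ∀ u : Circle, u ≠ 1 → w u ≠ 0 := by
    intro u hu h
    have h1 := ENNReal.ofReal_eq_zero.1 h
    have h2 := norm_le_zero_iff.1 h1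
    exact hu (Circle.coe_eq_one.1 (sub_eq_zero.1 h2).symm)
  have hmeas : MeasurableSet ({1}ᶜ : Set Circle) := (measurableSet_singleton 1).compl
  have hL : lengthMeasure.restrict {1}ᶜ = lengthMeasure :=
    Measure.restrict_eq_self_of_ae_mem (ae_ne_one.mono fun u hu => hu)
  have h1 : (P.restrict {1}ᶜ).withDensity w = lengthMeasure.withDensity (d * w) := by
    rw [← restrict_withDensity hmeas, heq, restrict_withDensity hmeas, hL]
  -- multiplying by the inverse weight recovers both measures, as the weight vanishes only at `1`
  have h2 := withDensity_inv_same (μ := P.restrict {1}ᶜ) hw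
    ((ae_restrict_mem hmeas).mono fun u hu => hw0 u hu)
    (.of_forall fun u => ENNReal.ofReal_ne_top)
  have h3 : lengthMeasure.withDensity ((d * w) * fun u => (w u)⁻¹) =
      (lengthMeasure.withDensity (d * w)).withDensity fun u => (w u)⁻¹ :=
    withDensity_mul _ (hd.mul hw) hw.inv
  rw [← h2, h1, ← h3]
  refine withDensity_congr_ae ?_
  filter_upwards [ae_ne_one, density_ae_eq (t := t)] with u hu hu'
  rw [hu', Pi.mul_apply, Pi.mul_apply, mul_assoc,
    ENNReal.mul_inv_cancel (hw0 u hu) ENNReal.ofReal_ne_top, mul_one]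

/-- The free unitary Poisson distribution exists and consists of an atom at `1` and a part with
density. -/
lemma exists_herglotz_poisson (ht : 0 < t) : ∃ P : Measure Circle, IsProbabilityMeasure P ∧
    (∀ z : ℂ, ‖z‖ < 1 → ∫ u : Circle, (1 + (u : ℂ) * z) / (1 - u * z) ∂P = 1 / r t z) ∧
    P = ENNReal.ofReal (1 - t) • Measure.dirac (1 : Circle) +
      lengthMeasure.withDensity (density t) := by
  set ρ : ℕ → ℝ := fun n => 1 - 1 / ((n : ℝ) + 1)
  have hρ0 : ∀ n, 0 ≤ ρ n := fun n => by
    have : 1 / ((n : ℝ) + 1) ≤ 1 := by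
      rw [div_le_one (by positivity)]; linarith [(Nat.cast_nonneg n : (0 : ℝ) ≤ n)]
    simp only [ρ]; linarith
  have hρ1 : ∀ n, ρ n < 1 := fun n => by
    have : 0 < 1 / ((n : ℝ) + 1) := by positivity
    simp only [ρ]; linarith
  have hρ : Tendsto ρ atTop (𝓝 1) := by
    have := (tendsto_one_div_add_atTop_nhds_zero_nat (𝕜 := ℝ)).const_sub 1
    rwa [sub_zero] at this
  have hne : ∀ z ∈ Metric.ball (0 : ℂ) 1, r t z ≠ 0 := fun z hz => by
    have hz' : ‖z‖ < 1 := by simpa using hz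
    exact r_ne_zero ht hz'.le fun h => by rw [h, norm_one] at hz'; exact lt_irrefl _ hz'
  obtain ⟨P, hPprob, hPz, F, hFne, hF, hlim⟩ := exists_herglotz_measure (h := fun z => 1 / r t z)
    (fun z hz => ((differentiableAt_const _).div (analyticOnNhd_r ht z hz).differentiableAt
      (hne z hz)).differentiableWithinAt)
    (by simp [r_zero])
    (fun z hz => by
      rw [one_div, Complex.inv_re]
      exact div_nonneg (re_r_nonneg ht (by simpa using (Metric.ball_subset_closedBall hz)))
        (Complex.normSq_nonneg _))
    (fun z hz => by
      rw [r_conj ht (by simpa using (Metric.ball_subset_closedBall hz))]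
      simp) hρ0 hρ1 hρ
  refine ⟨P, hPprob, hPz, ?_⟩
  -- `(1 - s) / (1 + s)` times the transform is `edgeQuotient t (r t s) / (1 + s)`
  have hatom : P.real {1} = max (1 - t) 0 := by
    have h1 := tendsto_atom P hρ0 hρ1 hρ
    have hlt : ∀ n, ‖(ρ n : ℂ)‖ < 1 := fun n => by
      rw [Complex.norm_real, Real.norm_of_nonneg (hρ0 n)]; exact hρ1 n
    have hρc : Tendsto (fun n => (ρ n : ℂ)) atTop (𝓝 1) := by
      rw [← Complex.ofReal_one]
      exact (Complex.continuous_ofReal.tendsto 1).comp hρ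
    have h2 : ∀ n, ((1 - ρ n) / (1 + ρ n) : ℂ) *
        ∫ u : Circle, (1 + (u : ℂ) * ρ n) / (1 - u * ρ n) ∂P =
        edgeQuotient t (r t (ρ n)) / (1 + ρ n) := by
      intro n
      rw [hPz _ (hlt n), ← one_sub_mul_inv_r ht (hlt n).le
        (fun h => by have := hlt n; rw [h, norm_one] at this; exact lt_irrefl _ this)]
      ring
    simp only [h2] at h1
    have h3 : Tendsto (fun n => edgeQuotient t (r t (ρ n)) / (1 + ρ n)) atTop
        (𝓝 (edgeQuotient t (r t 1) / (1 + 1))) := by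
      refine Tendsto.div ?_ (tendsto_const_nhds.add hρc) (by norm_num)
      refine (continuousOn_edgeQuotient_r ht 1 (by simp)).tendsto.comp
        (tendsto_nhdsWithin_iff.2 ⟨hρc, .of_forall fun n => ?_⟩)
      simpa using (hlt n).le
    have h4 := tendsto_nhds_unique h1 h3
    rw [edgeQuotient_r_one ht] at h4
    have h5 : (2 * (max (1 - t) 0 : ℝ) : ℂ) / (1 + 1) = (max (1 - t) 0 : ℝ) := by ring
    rw [h5] at h4
    exact_mod_cast h4
  have hatom' : P {1} = ENNReal.ofReal (1 - t) := by
    rw [← ENNReal.ofReal_toReal (measure_ne_top P {1})]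
    change ENNReal.ofReal (P.real {1}) = _
    rw [hatom]
    rcases le_total 0 (1 - t) with h | h
    · rw [max_eq_left h]
    · rw [max_eq_right h, ENNReal.ofReal_zero, ENNReal.ofReal_of_nonpos h]
  rw [← restrict_compl_eq ht (integral_weight_eq ht hF hρ0 hρ1 hρ hlim), ← hatom',
    ← Measure.restrict_singleton]
  exact (Measure.restrict_add_restrict_compl (measurableSet_singleton 1)).symm

/-- Since `1 + 2 ψ` is the Herglotz transform `1 / r_t`, the equation satisfied by `r_t` says that
`chi t` is a left inverse of `ψ` at the origin. -/
lemma isFreeUnitaryPoisson_of_herglotz (ht : 0 < t) {P : Measure Circle} [IsProbabilityMeasure P]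
    (hP : ∀ z : ℂ, ‖z‖ < 1 →
      ∫ u : Circle, (1 + (u : ℂ) * z) / (1 - u * z) ∂P = 1 / r t z) :
    IsFreeUnitaryPoisson t P := by
  have hpsi : ∀ z : ℂ, ‖z‖ < 1 → 1 + 2 * psi P z = 1 / r t z := by
    intro z hz
    have hk : Continuous fun u : Circle => (u : ℂ) * z / (1 - u * z) :=
      Continuous.div (by fun_prop) (by fun_prop) fun u => one_sub_mul_ne_zero u hz
    rw [← hP z hz]
    have h1 : ∀ u : Circle, (1 + (u : ℂ) * z) / (1 - u * z) =
        1 + 2 * ((u : ℂ) * z / (1 - u * z)) := by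
      intro u
      have := one_sub_mul_ne_zero u hz
      field_simp
      ring
    simp only [h1]
    rw [integral_add (integrable_const _) ((integrable_circle P hk).const_mul 2),
      integral_const_mul, psi]
    simp
  have hchi : ∀ᶠ z in 𝓝 (0 : ℂ), chi t (psi P z) = z := by
    filter_upwards [Metric.ball_mem_nhds (0 : ℂ) one_pos] with z hz
    have hz' : ‖z‖ < 1 := by simpa using hz
    have hr : r t z ≠ 0 :=
      r_ne_zero ht hz'.le fun h => by rw [h, norm_one] at hz'; exact lt_irrefl _ hz'
    have h1 : psi P z = (1 - r t z) / (2 * r t z) := by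
      have := hpsi z hz'
      field_simp at this ⊢
      linear_combination this
    have h2 : 1 + psi P z = (1 + r t z) / (2 * r t z) := by
      rw [h1]; field_simp; ring
    have h3 : psi P z + 1 / 2 = 1 / (2 * r t z) := by
      rw [h1]; field_simp; ring
    rw [chi, h3, h2, h1]
    conv_rhs => rw [← r_equation ht hz'.le]
    congr 1
    · field_simp
    · congr 1
      field_simp
  have hpd := hasStrictDerivAt_psi P
  have hpc : Tendsto (psi P) (𝓝 0) (𝓝 0) := by
    simpa [ContinuousAt, psi_zero] using hpd.hasDerivAt.continuousAt
  have hcc : Tendsto (chi t) (𝓝 0) (𝓝 0) := by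
    simpa [ContinuousAt, chi_zero] using (analyticAt_chi t).continuousAt
  refine ⟨inferInstance, ?_, chi t, ⟨analyticAt_chi t, chi_zero, ?_, hchi⟩, ?_⟩
  · -- the first moment is the derivative of `ψ` at `0`; it is nonzero as `ψ` has a left inverse
    intro h0
    have hcd : HasDerivAt (chi t) (Complex.exp (2 * t)) (psi P 0) := by
      rw [psi_zero]; exact (hasStrictDerivAt_chi t).hasDerivAt
    have h1 : HasDerivAt (chi t ∘ psi P) (Complex.exp (2 * t) * 0) 0 := by
      exact h0 ▸ hcd.comp 0 hpd.hasDerivAt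
    have h2 : HasDerivAt (chi t ∘ psi P) 1 0 := (hasDerivAt_id 0).congr_of_eventuallyEq hchi
    have := h1.unique h2
    simp at this
  · -- `χ` is injective near the origin, so the left inverse is also a right inverse
    have hL := (hasStrictDerivAt_chi t).eventually_left_inverse (Complex.exp_ne_zero _)
    filter_upwards [hL, hcc.eventually hchi, (hpc.comp hcc).eventually hL] with z h1 h2 h3
    simp only [Function.comp] at h3
    rw [h2, h1] at h3
    exact h3.symm
  · have hne : ∀ᶠ z in 𝓝 (0 : ℂ), 1 + z ≠ 0 :=
      ContinuousAt.eventually_ne (by fun_prop) (by simp)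
    filter_upwards [self_mem_nhdsWithin, mem_nhdsWithin_of_mem_nhds hne] with z hz0 hz1
    have hz0' : z ≠ 0 := hz0
    rw [chi]
    field_simp

end FreePoisson

/-! ### The density and the real values of `ζ_t` -/

namespace FreePoisson

variable {t : ℝ}

lemma angularDensity_eq_inv_r (ht : 0 < t) (θ : ℝ) :
    angularDensity t θ = 1 / (2 * Real.pi) * (1 / r t (Circle.exp θ : ℂ)).re := by
  rw [angularDensity, density]
  split_ifs with h h'
  · rw [h.2, Circle.coe_one, r_one_of_le ht h.1]; simp
  · rw [h.2, Circle.coe_one, r_one_of_le ht h.1]; simp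
  · exact ENNReal.toReal_ofReal (realDensity_nonneg ht (Circle.exp θ))

lemma r_circle_exp (ht : 0 < t) (θ : ℝ) :
    r t (Circle.exp θ : ℂ) = -Complex.I * Complex.tan (zeta t ((θ / 2 : ℝ) : ℂ)) := by
  rw [← r_exp ht (by simp), Circle.coe_exp]
  congr 2
  push_cast
  ring

/-- This also holds at the points where `r_t` and `tan ζ_t` vanish, where both sides are `0`. -/
lemma angularDensity_eq_cot (ht : 0 < t) (θ : ℝ) :
    angularDensity t θ =
      -(1 / (2 * Real.pi)) * (Complex.cot (zeta t ((θ / 2 : ℝ) : ℂ))).im := by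
  have h (z : ℂ) : 1 / (-Complex.I * Complex.tan z) = Complex.I * Complex.cot z := by
    rw [one_div, mul_inv, inv_neg, Complex.inv_I, neg_neg, Complex.tan, inv_div, Complex.cot]
  rw [angularDensity_eq_inv_r ht, r_circle_exp ht, h, Complex.I_mul_re]
  ring

lemma angularDensity_eq_shc (ht : 0 < t) (θ : ℝ) :
    angularDensity t θ = 1 / (2 * Real.pi) *
      ((zeta t ((θ / 2 : ℝ) : ℂ)).im * shc (zeta t ((θ / 2 : ℝ) : ℂ)).im /
        Complex.normSq (Complex.sin (zeta t ((θ / 2 : ℝ) : ℂ)))) := by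
  rw [angularDensity_eq_cot ht, im_cot]
  ring

lemma angularDensity_neg (ht : 0 < t) (θ : ℝ) : angularDensity t (-θ) = angularDensity t θ := by
  have h1 : ((-θ / 2 : ℝ) : ℂ) = -(starRingEnd ℂ) ((θ / 2 : ℝ) : ℂ) := by
    rw [Complex.conj_ofReal]; push_cast; ring
  rw [angularDensity_eq_shc ht, angularDensity_eq_shc ht, h1, zeta_neg_conj ht (by simp),
    normSq_sin, normSq_sin]
  simp

lemma tendsto_half (θ : ℝ) : Tendsto (fun x : ℝ => ((x / 2 : ℝ) : ℂ)) (𝓝 θ)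
    (𝓝[{w : ℂ | 0 ≤ w.im}] ((θ / 2 : ℝ) : ℂ)) := by
  refine tendsto_nhdsWithin_iff.2 ⟨?_, .of_forall fun x => by simp⟩
  exact (Continuous.tendsto (by fun_prop : Continuous fun x : ℝ => ((x / 2 : ℝ) : ℂ)) θ)

lemma tendsto_zeta_half (ht : 0 < t) (θ : ℝ) : Tendsto (fun x : ℝ => zeta t ((x / 2 : ℝ) : ℂ)) (𝓝 θ)
    (𝓝 (zeta t ((θ / 2 : ℝ) : ℂ))) :=
  (continuousOn_zeta ht _ (by simp)).tendsto.comp (tendsto_half θ)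

lemma analyticAt_cot {z : ℂ} (hz : Complex.sin z ≠ 0) : AnalyticAt ℂ Complex.cot z :=
  Complex.analyticAt_cos.div Complex.analyticAt_sin hz

/-- The density is positive and analytic wherever `ζ_t` is not real. -/
lemma analyticAt_angularDensity (ht : 0 < t) {θ : ℝ}
    (h : 0 < (zeta t ((θ / 2 : ℝ) : ℂ)).im) :
    AnalyticAt ℝ (angularDensity t) θ ∧ 0 < angularDensity t θ := by
  have hs := sin_ne_zero_of_im_pos h
  constructor
  · have hreg := zeta_mem_region ht (θ := ((θ / 2 : ℝ) : ℂ)) (by simp)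
    obtain ⟨g, hg, hgz⟩ := exists_analyticAt_eq_zeta ht (θ := ((θ / 2 : ℝ) : ℂ)) (by simp)
      (deriv_tanMap_ne_zero ht hreg h)
    have hval : zeta t ((θ / 2 : ℝ) : ℂ) = g ((θ / 2 : ℝ) : ℂ) :=
      hgz.self_of_nhdsWithin (by simp)
    have hmul : AnalyticAt ℂ (fun z : ℂ => z / 2) (θ : ℂ) := analyticAt_id.div_const
    have hc : ((θ / 2 : ℝ) : ℂ) = (θ : ℂ) / 2 := by push_cast; rfl
    rw [hval, hc] at hs
    rw [hc] at hg
    have h1 : AnalyticAt ℂ (fun z : ℂ => g (z / 2)) (θ : ℂ) :=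
      AnalyticAt.comp (g := g) (f := fun z : ℂ => z / 2) hg hmul
    have h2 : AnalyticAt ℂ (fun z : ℂ => Complex.cot (g (z / 2))) (θ : ℂ) :=
      AnalyticAt.comp (g := Complex.cot) (f := fun z : ℂ => g (z / 2)) (analyticAt_cot hs) h1
    refine ((analyticAt_const (v := -(1 / (2 * Real.pi)))).mul h2.im_ofReal).congr ?_
    filter_upwards [(tendsto_half θ).eventually hgz] with x hx
    rw [angularDensity_eq_cot ht, hx]
    simp
  · rw [angularDensity_eq_shc ht]
    have h1 : 0 < shc (zeta t ((θ / 2 : ℝ) : ℂ)).im := one_pos.trans (one_lt_shc h)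
    have h2 := Complex.normSq_pos.2 hs
    positivity

lemma im_zeta_pos_of_one_lt (h : 1 < t) {θ : ℂ} (hθ : 0 ≤ θ.im) : 0 < (zeta t θ).im := by
  have ht : 0 < t := one_pos.trans h
  have hreg := zeta_mem_region ht hθ
  refine lt_of_le_of_ne hreg.1 fun h0 => ?_
  have h1 := le_normSq_cos ht hreg
  rw [normSq_cos, ← h0, Real.sinh_zero] at h1
  nlinarith [Real.sin_sq_add_cos_sq (zeta t θ).re, sq_nonneg (Real.sin (zeta t θ).re)]

lemma cos_arccos_sqrt (h : t ≤ 1) : Real.cos (Real.arccos √t) = √t :=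
  Real.cos_arccos (by linarith [Real.sqrt_nonneg t]) (Real.sqrt_le_one.2 h)

lemma sin_arccos_sqrt (ht : 0 < t) : Real.sin (Real.arccos √t) = √(1 - t) := by
  rw [Real.sin_arccos, Real.sq_sqrt ht.le]

lemma arccos_sqrt_lt (ht : 0 < t) : Real.arccos √t < Real.pi / 2 := by
  rw [Real.arccos_lt_pi_div_two]; exact Real.sqrt_pos.2 ht

lemma edge_eq_sub_mul (ht : 0 < t) (h : t ≤ 1) : edge t = Real.arccos √t -
    Real.sin (Real.arccos √t) * Real.cos (Real.arccos √t) := by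
  rw [edge, cos_arccos_sqrt h, sin_arccos_sqrt ht, mul_comm t, Real.sqrt_mul (by linarith)]

/-- The edge `x_t` is the image of the critical point `arccos √t` of `x ↦ x - t tan x`. -/
lemma edge_eq_sub_tan (ht : 0 < t) (h : t ≤ 1) : edge t = Real.arccos √t -
    t * Real.tan (Real.arccos √t) := by
  rw [edge_eq_sub_mul ht h, Real.tan_eq_sin_div_cos, cos_arccos_sqrt h]
  have h2 := Real.mul_self_sqrt ht.le
  field_simp
  linear_combination -Real.sin (Real.arccos √t) * h2

lemma arccos_sqrt_pos (h : t < 1) : 0 < Real.arccos √t := by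
  rw [Real.arccos_pos, Real.sqrt_lt' one_pos]; simpa using h

lemma edge_pos (ht : 0 < t) (h : t < 1) : 0 < edge t := by
  have ha := arccos_sqrt_pos h
  have h1 : Real.sin (2 * Real.arccos √t) < 2 * Real.arccos √t := Real.sin_lt (by positivity)
  rw [Real.sin_two_mul] at h1
  rw [edge_eq_sub_mul ht h.le]
  linarith

lemma edge_lt (ht : 0 < t) : edge t < Real.pi / 2 := by
  have := arccos_sqrt_lt ht
  rw [edge]
  linarith [Real.sqrt_nonneg (t * (1 - t))]

lemma edge_one : edge 1 = 0 := by simp [edge]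

lemma cos_pos_of_abs_le (ht : 0 < t) {x : ℝ} (hx : |x| ≤ Real.arccos √t) : 0 < Real.cos x := by
  have := arccos_sqrt_lt ht
  have := abs_le.1 hx
  exact Real.cos_pos_of_mem_Ioo ⟨by linarith, by linarith⟩

lemma le_cos_sq (ht : 0 < t) (h : t ≤ 1) {x : ℝ} (hx : |x| ≤ Real.arccos √t) :
    t ≤ Real.cos x ^ 2 := by
  have h1 : √t ≤ Real.cos x := by
    rw [← cos_arccos_sqrt h, ← Real.cos_abs x]
    exact Real.cos_le_cos_of_nonneg_of_le_pi (abs_nonneg x) (Real.arccos_le_pi _) hx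
  calc t = √t ^ 2 := (Real.sq_sqrt ht.le).symm
    _ ≤ Real.cos x ^ 2 := pow_le_pow_left₀ (Real.sqrt_nonneg t) h1 2

lemma tanMap_ofReal (x : ℝ) : tanMap t (x : ℂ) = ((x - t * Real.tan x : ℝ) : ℂ) := by
  rw [tanMap]; push_cast; rfl

lemma ofReal_mem_region {x : ℝ} : (x : ℂ) ∈ region t ↔ t ≤ Real.cos x ^ 2 := by
  simp [region, shc_zero, normSq_cos]

lemma monotoneOn_sub_tan (ht : 0 < t) (h : t ≤ 1) :
    MonotoneOn (fun x : ℝ => x - t * Real.tan x) (Icc (-Real.arccos √t) (Real.arccos √t)) := by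
  have hd : ∀ x ∈ Icc (-Real.arccos √t) (Real.arccos √t),
      HasDerivAt (fun x : ℝ => x - t * Real.tan x) (1 - t * (1 / Real.cos x ^ 2)) x :=
    fun x hx => (hasDerivAt_id x).sub
      ((Real.hasDerivAt_tan (cos_pos_of_abs_le ht (abs_le.2 hx)).ne').const_mul t)
  refine monotoneOn_of_deriv_nonneg (convex_Icc _ _)
    (fun x hx => (hd x hx).continuousAt.continuousWithinAt)
    (fun x hx => (hd x (interior_subset hx)).differentiableAt.differentiableWithinAt)
    fun x hx => ?_
  have hx' := interior_subset hx
  rw [(hd x hx').deriv, sub_nonneg, mul_one_div]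
  exact div_le_one_of_le₀ (le_cos_sq ht h (abs_le.2 hx')) (sq_nonneg _)

/-- Between the two edges, `ζ_t` is real. -/
lemma im_zeta_eq_zero (ht : 0 < t) (h : t ≤ 1) {θ : ℝ} (hθ : |θ| ≤ edge t) :
    (zeta t (θ : ℂ)).im = 0 := by
  have ha := Real.arccos_nonneg √t
  have hcont : ContinuousOn (fun x : ℝ => x - t * Real.tan x)
      (Icc (-Real.arccos √t) (Real.arccos √t)) := fun x hx =>
    (((hasDerivAt_id x).sub ((Real.hasDerivAt_tan
      (cos_pos_of_abs_le ht (abs_le.2 hx)).ne').const_mul t)).continuousAt).continuousWithinAt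
  have hivt := intermediate_value_Icc (by linarith) hcont
  have he := edge_eq_sub_tan ht h
  simp only [Real.tan_neg] at hivt
  obtain ⟨x, hx, hxθ⟩ := hivt (by
    have := abs_le.1 hθ
    exact ⟨by linarith, by linarith⟩ : θ ∈ _)
  have : zeta t (θ : ℂ) = x := by
    apply zeta_eq ht (ofReal_mem_region.2 (le_cos_sq ht h (abs_le.2 hx)))
    rw [tanMap_ofReal]
    exact_mod_cast hxθ
  rw [this, Complex.ofReal_im]

/-- Conversely, `ζ_t` is real only over the translates of `[-x_t, x_t]` by multiples of `π`. -/
lemma im_zeta_pos (ht : 0 < t) (h : t ≤ 1) {θ : ℝ} (hθ : |θ| ≤ Real.pi / 2)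
    (hθ' : edge t < |θ|) : 0 < (zeta t (θ : ℂ)).im := by
  have hreg := zeta_mem_region ht (θ := (θ : ℂ)) (by simp)
  refine lt_of_le_of_ne hreg.1 fun h0 => ?_
  obtain ⟨x, hx⟩ : ∃ x : ℝ, zeta t (θ : ℂ) = x :=
    ⟨(zeta t (θ : ℂ)).re, Complex.ext rfl (by simpa using h0.symm)⟩
  have hF := tanMap_zeta ht (θ := (θ : ℂ)) (by simp)
  rw [hx] at hreg hF
  rw [ofReal_mem_region] at hreg
  rw [tanMap_ofReal] at hF
  have hF' : x - t * Real.tan x = θ := by exact_mod_cast hF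
  -- move `x` by a multiple of `π` into `[-arccos √t, arccos √t]`, where `x - t tan x` is monotone
  set k : ℤ := round (x / Real.pi)
  have hpi := Real.pi_pos
  have hk : |x - k * Real.pi| ≤ Real.pi / 2 := by
    have h1 := abs_sub_round (x / Real.pi)
    have h2 : x - k * Real.pi = (x / Real.pi - k) * Real.pi := by field_simp
    rw [h2, abs_mul, abs_of_pos hpi]
    nlinarith
  have hcos : √t ≤ Real.cos (x - k * Real.pi) := by
    have h1 : 0 ≤ Real.cos (x - k * Real.pi) :=
      Real.cos_nonneg_of_mem_Icc ⟨by linarith [(abs_le.1 hk).1], (abs_le.1 hk).2⟩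
    apply Real.sqrt_le_iff.2 ⟨h1, ?_⟩
    rw [Real.cos_sub_int_mul_pi, mul_pow, ← zpow_natCast ((-1 : ℝ) ^ k), ← zpow_mul, mul_comm k,
      zpow_mul]
    simpa using hreg
  have hxa : |x - k * Real.pi| ≤ Real.arccos √t := by
    rw [← Real.cos_abs] at hcos
    rw [← Real.arccos_cos (abs_nonneg _) (hk.trans (by linarith))]
    exact Real.arccos_le_arccos hcos
  have hmono := monotoneOn_sub_tan ht h
  have hmem := abs_le.1 hxa
  have h1 := hmono (show -Real.arccos √t ∈ _ from ⟨le_rfl, by linarith⟩) hmem hmem.1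
  have h2 := hmono hmem (show Real.arccos √t ∈ _ from ⟨by linarith, le_rfl⟩) hmem.2
  have he := edge_eq_sub_tan ht h
  simp only [Real.tan_neg, Real.tan_sub_int_mul_pi] at h1 h2
  have h3 : |θ - k * Real.pi| ≤ edge t := abs_le.2 ⟨by linarith, by linarith⟩
  -- only the translate by `0` meets `[-π / 2, π / 2]`
  have hk0 : k = 0 := by
    have h6 := abs_le.1 hθ
    have h7 : (k : ℝ) < 1 := by
      by_contra hcon
      push Not at hcon
      nlinarith
    have h8 : (-1 : ℝ) < k := by
      by_contra hcon
      push Not at hcon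
      nlinarith
    have h9 : k < 1 := by exact_mod_cast h7
    have h10 : -1 < k := by exact_mod_cast h8
    omega
  rw [hk0] at h3
  simp at h3
  linarith

lemma angularDensity_eq_zero (ht : 0 < t) (h : t ≤ 1) {θ : ℝ} (hθ : |θ| ≤ 2 * edge t) :
    angularDensity t θ = 0 := by
  have h1 : |θ / 2| ≤ edge t := by
    rw [abs_div, abs_of_pos (two_pos : (0 : ℝ) < 2)]; linarith
  rw [angularDensity_eq_shc ht, im_zeta_eq_zero ht h h1]
  simp

lemma analyticAt_angularDensity_of_edge_lt (ht : 0 < t) (h : t ≤ 1) {θ : ℝ} (hθ : |θ| ≤ Real.pi)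
    (hθ' : 2 * edge t < |θ|) : AnalyticAt ℝ (angularDensity t) θ ∧ 0 < angularDensity t θ := by
  have h1 : |θ / 2| = |θ| / 2 := by rw [abs_div, abs_of_pos (two_pos : (0 : ℝ) < 2)]
  exact analyticAt_angularDensity ht (im_zeta_pos ht h (by rw [h1]; linarith)
    (by rw [h1]; linarith))

lemma continuousAt_angularDensity (ht : 0 < t) (h : t < 1) {θ : ℝ} (hθ : |θ| ≤ Real.pi) :
    ContinuousAt (angularDensity t) θ := by
  have he := edge_pos ht h
  rcases lt_or_ge |θ| (2 * edge t) with h1 | h1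
  · have h2 : ∀ᶠ x in 𝓝 θ, |x| < 2 * edge t :=
      (continuous_abs.tendsto θ).eventually (gt_mem_nhds h1)
    refine (continuousAt_const (y := (0 : ℝ))).congr ?_
    filter_upwards [h2] with x hx
    exact (angularDensity_eq_zero ht h.le hx.le).symm
  · have hs : Complex.sin (zeta t ((θ / 2 : ℝ) : ℂ)) ≠ 0 := by
      intro h0
      have hF := tanMap_zeta ht (θ := ((θ / 2 : ℝ) : ℂ)) (by simp)
      obtain ⟨k, hk⟩ := Complex.sin_eq_zero_iff.1 h0
      rw [tanMap, Complex.tan, h0, zero_div, mul_zero, sub_zero, hk] at hF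
      have h2 : (k : ℝ) * Real.pi = θ / 2 := by exact_mod_cast hF
      have h5 := abs_le.1 hθ
      have h7 : (k : ℝ) < 1 := by
        by_contra hcon
        push Not at hcon
        nlinarith
      have h8 : (-1 : ℝ) < k := by
        by_contra hcon
        push Not at hcon
        nlinarith
      have h9 : k < 1 := by exact_mod_cast h7
      have h10 : -1 < k := by exact_mod_cast h8
      obtain rfl : k = 0 := by omega
      have h3 : θ = 0 := by simp at h2; linarith
      rw [h3, abs_zero] at h1
      linarith
    -- away from `θ = 0`, `sin ζ_t` does not vanish, so the formula with `cot` is continuous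
    have hfun : angularDensity t = fun θ => -(1 / (2 * Real.pi)) *
        (Complex.cot (zeta t ((θ / 2 : ℝ) : ℂ))).im := funext (angularDensity_eq_cot ht)
    rw [hfun]
    refine ContinuousAt.mul continuousAt_const (Complex.continuous_im.continuousAt.comp ?_)
    exact (analyticAt_cot hs).continuousAt.tendsto.comp (tendsto_zeta_half ht θ)

end FreePoisson

/-! ### The square-root edge for `t < 1` -/

namespace FreePoisson

variable {t : ℝ}

/-- A holomorphic function with a double zero and negative second derivative there has a holomorphic
square root, here normalized to have derivative in `-i (0, ∞)`. -/
lemma exists_analyticAt_sq_eq {f : ℂ → ℂ} {a : ℂ} (hf : AnalyticAt ℂ f a) (h0 : f a = 0)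
    (h1 : deriv f a = 0) {T : ℝ} (hT : 0 < T) (h2 : deriv (deriv f) a = -2 * T) :
    ∃ (W : ℂ → ℂ) (K : ℝ), 0 < K ∧ AnalyticAt ℂ W a ∧ W a = 0 ∧
      deriv W a = -Complex.I * K ∧ ∀ᶠ z in 𝓝 a, W z ^ 2 = f z := by
  have hp := hf.hasFPowerSeriesAt.has_fpower_series_iterate_dslope_fslope 2
  set G : ℂ → ℂ := (Function.swap dslope a)^[2] f with hG
  have hGan : AnalyticAt ℂ G a := hp.analyticAt
  have hGa : G a = -T := by
    have h := hp.coeff_zero ![]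
    have h' := FormalMultilinearSeries.coeff_iterate_fslope
      (p := FormalMultilinearSeries.ofScalars ℂ (fun n => iteratedDeriv n f a / (n.factorial : ℂ))) 2 0
    rw [FormalMultilinearSeries.coeff_ofScalars] at h'
    have h3 : iteratedDeriv 2 f a = -2 * T := by
      rw [iteratedDeriv_succ, iteratedDeriv_one, h2]
    rw [zero_add, h3] at h'
    rw [← h]
    refine Eq.trans ?_ (h'.trans ?_)
    · rw [FormalMultilinearSeries.coeff]
      congr 1
      exact Subsingleton.elim _ _
    · rw [Nat.factorial_two]
      push_cast
      ring
  have hfac : ∀ z, f z = (z - a) ^ 2 * G z := by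
    intro z
    have e1 := sub_smul_dslope f a z
    have e2 := sub_smul_dslope (dslope f a) a z
    rw [dslope_same, h1, sub_zero, smul_eq_mul] at e2
    rw [h0, sub_zero, smul_eq_mul] at e1
    have e3 : G z = dslope (dslope f a) a z := rfl
    rw [e3, ← e1, ← e2]
    ring
  have hslit : -G a ∈ Complex.slitPlane := by
    rw [hGa, neg_neg]; exact Complex.ofReal_mem_slitPlane.2 hT
  set S : ℂ → ℂ := fun z => Complex.exp (Complex.log (-G z) / 2)
  have hSan : AnalyticAt ℂ S a := ((hGan.neg.clog hslit).div_const).cexp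
  have hSa : S a = (Real.exp (Real.log T / 2) : ℝ) := by
    simp only [S]
    rw [hGa, neg_neg, ← Complex.ofReal_log hT.le]
    push_cast
    rfl
  have hSsq : ∀ᶠ z in 𝓝 a, S z ^ 2 = -G z := by
    have hne : ∀ᶠ z in 𝓝 a, -G z ≠ 0 :=
      hGan.neg.continuousAt.eventually_ne (Complex.slitPlane_ne_zero hslit)
    filter_upwards [hne] with z hz
    simp only [S]
    rw [← Complex.exp_nat_mul]
    push_cast
    rw [mul_div_cancel₀ _ two_ne_zero, Complex.exp_log hz]
  refine ⟨fun z => -Complex.I * ((z - a) * S z), Real.exp (Real.log T / 2), Real.exp_pos _, ?_, ?_,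
    ?_, ?_⟩
  · exact analyticAt_const.mul ((analyticAt_id.sub analyticAt_const).mul hSan)
  · simp
  · have hd := ((hasDerivAt_id a).sub_const a).mul hSan.differentiableAt.hasDerivAt
    have hd' := (hd.const_mul (-Complex.I)).deriv
    refine hd'.trans ?_
    simp [hSa]
  · filter_upwards [hSsq] with z hz
    rw [hfac z]
    linear_combination (z - a) ^ 2 * Complex.I ^ 2 * hz - (z - a) ^ 2 * G z * Complex.I_sq

lemma deriv_tanMap_eventuallyEq {ζ : ℂ} (h : Complex.cos ζ ≠ 0) :
    deriv (tanMap t) =ᶠ[𝓝 ζ] fun z => 1 - t * (1 / Complex.cos z ^ 2) := by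
  filter_upwards [Complex.continuous_cos.continuousAt.eventually_ne h] with z hz
  exact (hasStrictDerivAt_tanMap hz).hasDerivAt.deriv

lemma deriv_deriv_tanMap {ζ : ℂ} (h : Complex.cos ζ ≠ 0) :
    deriv (deriv (tanMap t)) ζ = -2 * t * Complex.sin ζ / Complex.cos ζ ^ 3 := by
  rw [(deriv_tanMap_eventuallyEq h).deriv_eq]
  have h1 := (((Complex.hasDerivAt_cos ζ).fun_pow 2).fun_inv (pow_ne_zero 2 h)).const_mul (t : ℂ)
  have h2 := h1.const_sub 1
  simp only [one_div]
  rw [h2.deriv]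
  field_simp
  push_cast
  ring

/-- `x_t` is a simple critical value of `tanMap t`, so `ζ_t` is an analytic function of
`√(θ - x_t)`; of the two branches of the square root, the one mapping into the upper half-plane is
the right one. -/
lemma hasSqrtEdge_right (ht : 0 < t) (h : t < 1) :
    HasSqrtEdge fun s => angularDensity t (2 * edge t + s) := by
  set a : ℝ := Real.arccos √t with ha
  have ha0 : 0 < a := arccos_sqrt_pos h
  have hapi : a < Real.pi / 2 := arccos_sqrt_lt ht
  have habs : |a| ≤ Real.arccos √t := by rw [abs_of_pos ha0]
  have hcospos : 0 < Real.cos a := cos_pos_of_abs_le ht habs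
  have hsinpos : 0 < Real.sin a := Real.sin_pos_of_pos_of_lt_pi ha0 (by linarith [Real.pi_pos])
  have hcosne : Complex.cos (a : ℂ) ≠ 0 := by
    rw [← Complex.ofReal_cos]; exact_mod_cast hcospos.ne'
  have hsinne : Complex.sin (a : ℂ) ≠ 0 := by
    rw [← Complex.ofReal_sin]; exact_mod_cast hsinpos.ne'
  have hcos2 : Complex.cos (a : ℂ) ^ 2 = t := by
    rw [← Complex.ofReal_cos, ha, cos_arccos_sqrt h.le, ← Complex.ofReal_pow, Real.sq_sqrt ht.le]
  have htne : (t : ℂ) ≠ 0 := by exact_mod_cast ht.ne'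
  have hFa : tanMap t (a : ℂ) = edge t := by
    rw [tanMap_ofReal, edge_eq_sub_tan ht h.le]
  have hzeta : zeta t ((edge t : ℝ) : ℂ) = a :=
    zeta_eq ht (ofReal_mem_region.2 (le_cos_sq ht h.le habs)) hFa
  have hFan : AnalyticAt ℂ (tanMap t) (a : ℂ) := analyticAt_tanMap hcosne
  have hTpos : 0 < Real.tan a := Real.tan_pos_of_pos_of_lt_pi_div_two ha0 hapi
  obtain ⟨W, K, hK, hWan, hWa, hWd, hWsq⟩ := exists_analyticAt_sq_eq
    (f := fun z => tanMap t z - edge t) (a := a) (T := Real.tan a) (hFan.sub analyticAt_const)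
    (by rw [hFa, sub_self])
    (by
      rw [deriv_sub_const, (hasStrictDerivAt_tanMap hcosne).hasDerivAt.deriv, hcos2]
      field_simp
      simp) hTpos
    (by
      have : deriv (fun z => tanMap t z - edge t) = deriv (tanMap t) := by
        ext z; rw [deriv_sub_const]
      rw [this, deriv_deriv_tanMap hcosne, ← hcos2, Complex.ofReal_tan, Complex.tan]
      field_simp)
  have hKc : (K : ℂ) ≠ 0 := by exact_mod_cast hK.ne'
  have hWd' : deriv W a ≠ 0 := by rw [hWd]; simp [hKc]
  set V : ℂ → ℂ := hWan.hasStrictDerivAt.localInverse _ _ _ hWd'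
  have hVan : AnalyticAt ℂ V 0 := by
    have := hWan.analyticAt_localInverse hWd'
    rwa [hWa] at this
  have hVW : ∀ᶠ z in 𝓝 (a : ℂ), V (W z) = z := hWan.hasStrictDerivAt.eventually_left_inverse hWd'
  have hV0 : V 0 = a := by
    have := hVW.self_of_nhds
    rwa [hWa] at this
  have hVd : HasDerivAt V (Complex.I / K) 0 := by
    have h1 := (hWan.hasStrictDerivAt.to_localInverse hWd').hasDerivAt
    rw [hWa] at h1
    refine h1.congr_deriv ?_
    rw [hWd, mul_inv, inv_neg, Complex.inv_I, neg_neg, ← div_eq_mul_inv]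
  -- this excludes the other branch of the square root, which leaves the upper half-plane
  have hneg : ∀ᶠ x : ℝ in 𝓝[<] 0, (V x).im < 0 := by
    have hVr : HasDerivAt (fun x : ℝ => V x) (Complex.I / K) 0 := by
      have hV' : HasDerivAt V (Complex.I / K) ((0 : ℝ) : ℂ) := by rwa [Complex.ofReal_zero]
      exact hV'.comp_ofReal
    have him : HasDerivAt (fun x : ℝ => (V x).im) (1 / K) 0 := by
      have h1 := Complex.imCLM.hasFDerivAt.comp_hasDerivAt (0 : ℝ) hVr
      have h2 : Complex.imCLM (Complex.I / K) = 1 / K := by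
        simp [Complex.div_im]
      rw [h2] at h1
      exact h1
    have hs := hasDerivAt_iff_tendsto_slope.1 him
    have hpos := (hs.mono_left (nhdsWithin_mono 0 fun x (hx : x < 0) => hx.ne)).eventually
      (lt_mem_nhds (by positivity : 0 < 1 / K))
    filter_upwards [hpos, self_mem_nhdsWithin] with x hx hx0
    have hx0' : x < 0 := hx0
    rw [slope_def_field, Complex.ofReal_zero, hV0, Complex.ofReal_im, sub_zero, sub_zero] at hx
    by_contra hcon
    push Not at hcon
    exact absurd hx (not_lt.2 (div_nonpos_of_nonneg_of_nonpos hcon hx0'.le))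
  have hzt : Tendsto (fun s : ℝ => zeta t (((2 * edge t + s) / 2 : ℝ) : ℂ)) (𝓝 0) (𝓝 (a : ℂ)) := by
    have h1 := tendsto_zeta_half ht (2 * edge t)
    rw [mul_div_cancel_left₀ _ two_ne_zero, hzeta] at h1
    refine h1.comp ?_
    have : Tendsto (fun s : ℝ => 2 * edge t + s) (𝓝 0) (𝓝 (2 * edge t + 0)) :=
      Continuous.tendsto (by fun_prop) 0
    rwa [add_zero] at this
  -- `W(ζ_t)² = s / 2`, so `ζ_t = V(±√(s / 2))`, and the sign is `+` as `Im ζ_t ≥ 0`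
  have hkey : ∀ᶠ s : ℝ in 𝓝[≥] 0,
      zeta t (((2 * edge t + s) / 2 : ℝ) : ℂ) = V ((√s / √2 : ℝ) : ℂ) := by
    have hsq : Tendsto (fun s : ℝ => -(√s / √2)) (𝓝[>] 0) (𝓝[<] 0) := by
      refine tendsto_nhdsWithin_iff.2 ⟨?_, ?_⟩
      · have : Tendsto (fun s : ℝ => -(√s / √2)) (𝓝 0) (𝓝 (-(√0 / √2))) :=
          Continuous.tendsto (by fun_prop) 0
        rw [Real.sqrt_zero, zero_div, neg_zero] at this
        exact this.mono_left nhdsWithin_le_nhds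
      · filter_upwards [self_mem_nhdsWithin] with s hs
        have hs' : 0 < s := hs
        have : 0 < √s / √2 := by positivity
        simpa using this
    have hn := hsq.eventually hneg
    rw [eventually_nhdsWithin_iff] at hn
    filter_upwards [mem_nhdsWithin_of_mem_nhds (hzt.eventually hVW),
      mem_nhdsWithin_of_mem_nhds (hzt.eventually hWsq), mem_nhdsWithin_of_mem_nhds hn,
      self_mem_nhdsWithin] with s h1 h2 h3 hs
    have hs' : 0 ≤ s := hs
    have h1' : V (W (zeta t (((2 * edge t + s) / 2 : ℝ) : ℂ))) =
      zeta t (((2 * edge t + s) / 2 : ℝ) : ℂ) := h1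
    have h2' : W (zeta t (((2 * edge t + s) / 2 : ℝ) : ℂ)) ^ 2 =
      tanMap t (zeta t (((2 * edge t + s) / 2 : ℝ) : ℂ)) - edge t := h2
    rw [tanMap_zeta ht (by simp)] at h2'
    have h4 : W (zeta t (((2 * edge t + s) / 2 : ℝ) : ℂ)) ^ 2 = ((√s / √2 : ℝ) : ℂ) ^ 2 := by
      rw [h2', ← Complex.ofReal_pow, div_pow, Real.sq_sqrt hs', Real.sq_sqrt zero_le_two]
      push_cast
      ring
    rcases sq_eq_sq_iff_eq_or_eq_neg.1 h4 with h5 | h5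
    · rw [← h5, h1']
    · rcases hs'.eq_or_lt with rfl | hs0
      · rw [← h1', h5]
        simp
      · exfalso
        have h6 := h3 hs0
        rw [Complex.ofReal_neg, ← h5, h1'] at h6
        exact absurd h6 (not_lt.2 (zeta_mem_region ht (by simp)).1)
  have hV0s : Complex.sin (V 0) ≠ 0 := by rwa [hV0]
  have hscale : AnalyticAt ℂ (fun x : ℂ => x / (√2 : ℝ)) ((0 : ℝ) : ℂ) := analyticAt_id.div_const
  have hcotan : AnalyticAt ℂ (fun x : ℂ => Complex.cot (V (x / (√2 : ℝ)))) ((0 : ℝ) : ℂ) := by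
    refine AnalyticAt.comp (g := Complex.cot) (f := fun x : ℂ => V (x / (√2 : ℝ))) ?_ ?_
    · apply analyticAt_cot
      simpa using hV0s
    · refine AnalyticAt.comp (g := V) (f := fun x : ℂ => x / (√2 : ℝ)) ?_ hscale
      simpa using hVan
  have hcotd : HasDerivAt Complex.cot (-(1 / Complex.sin (a : ℂ) ^ 2)) (V 0) := by
    rw [hV0]
    refine ((Complex.hasDerivAt_cos a).div (Complex.hasDerivAt_sin a) hsinne).congr_deriv ?_
    field_simp
    linear_combination -Complex.sin_sq_add_cos_sq (a : ℂ)
  have hcomp : HasDerivAt (fun x : ℝ => Complex.cot (V (x / (√2 : ℝ))))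
      (-(1 / Complex.sin (a : ℂ) ^ 2) * (Complex.I / K * (1 / (√2 : ℝ)))) 0 := by
    have hid : HasDerivAt (fun x : ℂ => x / (√2 : ℝ)) (1 / (√2 : ℝ)) ((0 : ℝ) : ℂ) :=
      (hasDerivAt_id _).div_const _
    have e0 : ((0 : ℝ) : ℂ) / (√2 : ℝ) = 0 := by simp
    have hV1 : HasDerivAt V (Complex.I / K) (((0 : ℝ) : ℂ) / (√2 : ℝ)) := by rwa [e0]
    have hV2 := hV1.comp ((0 : ℝ) : ℂ) hid
    have hc1 : HasDerivAt Complex.cot (-(1 / Complex.sin (a : ℂ) ^ 2))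
        ((V ∘ fun x : ℂ => x / (√2 : ℝ)) ((0 : ℝ) : ℂ)) := by
      simpa only [Function.comp, e0] using hcotd
    exact (hc1.comp ((0 : ℝ) : ℂ) hV2).comp_ofReal
  have himd : HasDerivAt (fun x : ℝ => -(1 / (2 * Real.pi)) * (Complex.cot (V (x / (√2 : ℝ)))).im)
      (1 / (2 * Real.pi) * (1 / (Real.sin a ^ 2 * K * √2))) 0 := by
    have h1 := Complex.imCLM.hasFDerivAt.comp_hasDerivAt (0 : ℝ) hcomp
    have h2 : Complex.imCLM (-(1 / Complex.sin (a : ℂ) ^ 2) * (Complex.I / K * (1 / (√2 : ℝ)))) =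
        -(1 / (Real.sin a ^ 2 * K * √2)) := by
      have h3 : -(1 / Complex.sin (a : ℂ) ^ 2) * (Complex.I / K * (1 / (√2 : ℝ))) =
          ((-(1 / (Real.sin a ^ 2 * K * √2)) : ℝ) : ℂ) * Complex.I := by
        push_cast
        field_simp
      rw [h3, Complex.imCLM_apply, Complex.im_ofReal_mul, Complex.I_im, mul_one]
    rw [h2] at h1
    refine (h1.const_mul (-(1 / (2 * Real.pi)))).congr_deriv ?_
    ring
  refine ⟨fun x => -(1 / (2 * Real.pi)) * (Complex.cot (V (x / (√2 : ℝ)))).im, ?_, ?_, ?_, ?_⟩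
  · exact analyticAt_const.mul hcotan.im_ofReal
  · simp only [Complex.ofReal_zero, zero_div, hV0]
    rw [im_cot]
    simp
  · rw [himd.deriv]
    positivity
  · filter_upwards [hkey] with s hs
    rw [angularDensity_eq_cot ht, hs]
    push_cast
    rfl

lemma hasSqrtEdge_left (ht : 0 < t) (h : t < 1) :
    HasSqrtEdge fun s => angularDensity t (-(2 * edge t) - s) := by
  have h1 := hasSqrtEdge_right ht h
  have h2 : (fun s => angularDensity t (-(2 * edge t) - s)) =
      fun s => angularDensity t (2 * edge t + s) := by
    ext s
    rw [← angularDensity_neg ht (2 * edge t + s)]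
    congr 1
    ring
  rwa [h2]

lemma hasDerivAt_edge_of_mem {u : ℝ} (h0 : 0 < u) (h1 : u < 1) :
    HasDerivAt (fun u => -edge u) (√((1 - u) / u)) u := by
  have hsq : HasDerivAt (fun u : ℝ => √u) (1 / (2 * √u)) u := Real.hasDerivAt_sqrt h0.ne'
  have hs0 := Real.sqrt_pos.2 h0
  have hs1 : √u < 1 := by rw [Real.sqrt_lt' one_pos]; simpa using h1
  have hc := (Real.hasDerivAt_arccos (x := √u) (by linarith) hs1.ne).comp u hsq
  have hp : HasDerivAt (fun u : ℝ => u * (1 - u)) (1 * (1 - u) + u * (-1)) u :=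
    (hasDerivAt_id u).mul ((hasDerivAt_id u).const_sub 1)
  have hpos : 0 < u * (1 - u) := mul_pos h0 (by linarith)
  have hp2 := hp.sqrt hpos.ne'
  refine (hc.sub hp2).neg.congr_deriv ?_
  rw [Real.sq_sqrt h0.le, Real.sqrt_div (by linarith), Real.sqrt_mul h0.le]
  have hv := Real.sqrt_pos.2 (by linarith : 0 < 1 - u)
  have e2 := Real.sq_sqrt (by linarith : 0 ≤ 1 - u)
  field_simp
  rw [e2]
  ring

lemma continuous_edge : Continuous edge := by
  unfold edge
  exact (Real.continuous_arccos.comp Real.continuous_sqrt).sub (by fun_prop)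

lemma edge_zero : edge 0 = Real.pi / 2 := by simp [edge]

lemma intervalIntegrable_edge (ht : 0 < t) (h : t < 1) :
    IntervalIntegrable (fun u : ℝ => √((1 - u) / u)) volume 0 t := by
  refine intervalIntegral.intervalIntegrable_deriv_of_nonneg (g := fun u => -edge u)
    continuous_edge.neg.continuousOn ?_ fun _ _ => Real.sqrt_nonneg _
  intro u hu
  rw [min_eq_left ht.le, max_eq_right ht.le] at hu
  exact hasDerivAt_edge_of_mem hu.1 (hu.2.trans h)

lemma edge_eq_integral (ht : 0 < t) (h : t < 1) :
    edge t = Real.pi / 2 - ∫ u in (0 : ℝ)..t, √((1 - u) / u) := by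
  rw [intervalIntegral.integral_eq_sub_of_hasDerivAt_of_le (f := fun u => -edge u) ht.le
    continuous_edge.neg.continuousOn
    (fun u hu => hasDerivAt_edge_of_mem hu.1 (hu.2.trans h)) (intervalIntegrable_edge ht h),
    edge_zero]
  ring

end FreePoisson

/-! ### The singularity at `t = 1` -/

namespace FreePoisson

/-- Integration of a second-order asymptotic expansion at the origin. -/
lemma tendsto_div_cube {𝕜 : Type*} [RCLike 𝕜] {f f' : 𝕜 → 𝕜} {c : 𝕜} (h0 : f 0 = 0)
    (hd : ∀ᶠ z in 𝓝 0, HasDerivAt f (f' z) z) (h0' : f' 0 = 0)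
    (hc : Tendsto (fun z => f' z / z ^ 2) (𝓝[≠] 0) (𝓝 c)) :
    Tendsto (fun z => f z / z ^ 3) (𝓝[≠] 0) (𝓝 (c / 3)) := by
  rw [Metric.tendsto_nhds]
  intro ε hε
  have h1 := (Metric.tendsto_nhds.1 hc) (ε / 2) (by positivity)
  rw [eventually_nhdsWithin_iff] at h1
  obtain ⟨δ, hδ, hball⟩ := Metric.eventually_nhds_iff_ball.1 (h1.and hd)
  filter_upwards [mem_nhdsWithin_of_mem_nhds (Metric.ball_mem_nhds (0 : 𝕜) hδ),
    self_mem_nhdsWithin] with z hz hz0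
  have hz0' : z ≠ 0 := hz0
  have hzn : ‖z‖ < δ := by simpa using hz
  have hsub : ∀ w ∈ Metric.closedBall (0 : 𝕜) ‖z‖, w ∈ Metric.ball (0 : 𝕜) δ := fun w hw =>
    Metric.closedBall_subset_ball hzn hw
  have hg : ∀ w ∈ Metric.closedBall (0 : 𝕜) ‖z‖, HasDerivWithinAt
      (fun w => f w - c / 3 * w ^ 3) (f' w - c / 3 * (3 * w ^ 2))
      (Metric.closedBall (0 : 𝕜) ‖z‖) w := fun w hw => by
    have h2 := (hball w (hsub w hw)).2.sub ((hasDerivAt_pow 3 w).const_mul (c / 3))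
    exact h2.hasDerivWithinAt
  have hbd : ∀ w ∈ Metric.closedBall (0 : 𝕜) ‖z‖,
      ‖f' w - c / 3 * (3 * w ^ 2)‖ ≤ ε / 2 * ‖z‖ ^ 2 := by
    intro w hw
    rcases eq_or_ne w 0 with rfl | hw0
    · rw [h0']
      simp only [ne_eq, OfNat.ofNat_ne_zero, not_false_eq_true, zero_pow, mul_zero, sub_zero,
        norm_zero]
      positivity
    · have h2 := (hball w (hsub w hw)).1 hw0
      rw [dist_eq_norm] at h2
      have h3 : f' w - c / 3 * (3 * w ^ 2) = (f' w / w ^ 2 - c) * w ^ 2 := by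
        field_simp
      rw [h3, norm_mul, norm_pow]
      have h4 : ‖w‖ ≤ ‖z‖ := by simpa using hw
      gcongr
  have h5 := (convex_closedBall (0 : 𝕜) ‖z‖).norm_image_sub_le_of_norm_hasDerivWithin_le hg hbd
    (Metric.mem_closedBall_self (norm_nonneg z)) (by simp : z ∈ Metric.closedBall (0 : 𝕜) ‖z‖)
  rw [h0] at h5
  simp only [ne_eq, OfNat.ofNat_ne_zero, not_false_eq_true, zero_pow, mul_zero, sub_zero] at h5
  have h6 : f z / z ^ 3 - c / 3 = (f z - c / 3 * z ^ 3) / z ^ 3 := by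
    field_simp
  rw [dist_eq_norm, h6, norm_div, norm_pow, div_lt_iff₀ (by positivity)]
  have h7 : 0 < ε / 2 * ‖z‖ ^ 3 := by positivity
  calc _ ≤ ε / 2 * ‖z‖ ^ 2 * ‖z‖ := h5
    _ < ε * ‖z‖ ^ 3 := by nlinarith

lemma tendsto_sinh_div : Tendsto (fun x : ℝ => Real.sinh x / x) (𝓝[≠] 0) (𝓝 1) := by
  have h := hasDerivAt_iff_tendsto_slope.1 (Real.hasDerivAt_sinh 0)
  rw [Real.cosh_zero] at h
  refine h.congr fun x => ?_
  rw [slope_def_field, Real.sinh_zero, sub_zero, sub_zero]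

lemma tendsto_sin_div : Tendsto (fun z : ℂ => Complex.sin z / z) (𝓝[≠] 0) (𝓝 1) := by
  have h := hasDerivAt_iff_tendsto_slope.1 (Complex.hasDerivAt_sin 0)
  rw [Complex.cos_zero] at h
  refine h.congr fun x => ?_
  rw [slope_def_field, Complex.sin_zero, sub_zero, sub_zero]

lemma tendsto_sinh_sub_self_div : Tendsto (fun x : ℝ => (Real.sinh x - x) / x ^ 3) (𝓝[≠] 0)
    (𝓝 (1 / 2 / 3)) := by
  refine tendsto_div_cube (f := fun x : ℝ => Real.sinh x - x) (f' := fun x => Real.cosh x - 1)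
    (by simp) (.of_forall fun x => (Real.hasDerivAt_sinh x).sub (hasDerivAt_id x)) (by simp) ?_
  have h1 : Tendsto (fun x : ℝ => x / 2) (𝓝[≠] 0) (𝓝[≠] 0) := by
    refine tendsto_nhdsWithin_iff.2 ⟨?_, ?_⟩
    · have : Tendsto (fun x : ℝ => x / 2) (𝓝 0) (𝓝 (0 / 2)) := Continuous.tendsto (by fun_prop) 0
      rw [zero_div] at this
      exact this.mono_left nhdsWithin_le_nhds
    · filter_upwards [self_mem_nhdsWithin] with x hx
      have hx' : x ≠ 0 := hx
      simpa using hx'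
  have h2 := ((tendsto_sinh_div.comp h1).pow 2).mul_const (1 / 2)
  rw [one_pow, one_mul] at h2
  refine h2.congr' ?_
  filter_upwards [self_mem_nhdsWithin] with x hx
  have h3 : Real.cosh x = 1 + 2 * Real.sinh (x / 2) ^ 2 := by
    have h4 := Real.cosh_two_mul (x / 2)
    rw [mul_div_cancel₀ _ two_ne_zero, Real.cosh_sq] at h4
    linarith
  simp only [Function.comp]
  rw [h3]
  field_simp
  ring

lemma tendsto_tanMap_one_div_cube :
    Tendsto (fun z : ℂ => tanMap 1 z / z ^ 3) (𝓝[≠] 0) (𝓝 (-1 / 3)) := by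
  have hne : ∀ᶠ z in 𝓝 (0 : ℂ), Complex.cos z ≠ 0 :=
    Complex.continuous_cos.continuousAt.eventually_ne (by simp)
  refine tendsto_div_cube (f' := fun z => 1 - (1 : ℝ) * (1 / Complex.cos z ^ 2)) (by simp [tanMap])
    (hne.mono fun z hz => (hasStrictDerivAt_tanMap hz).hasDerivAt) (by simp) ?_
  have hcos : Tendsto (fun z : ℂ => 1 / Complex.cos z ^ 2) (𝓝[≠] 0) (𝓝 1) := by
    have : ContinuousAt (fun z : ℂ => 1 / Complex.cos z ^ 2) 0 :=
      ContinuousAt.div (by fun_prop) (by fun_prop) (by simp)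
    have h := this.tendsto
    simp only [Complex.cos_zero, one_pow, div_one] at h
    exact h.mono_left nhdsWithin_le_nhds
  have h2 := ((tendsto_sin_div.pow 2).mul hcos).neg
  rw [one_pow, one_mul] at h2
  refine h2.congr' ?_
  filter_upwards [self_mem_nhdsWithin, mem_nhdsWithin_of_mem_nhds hne] with z hz hz1
  have hz' : z ≠ 0 := hz
  have h3 := Complex.sin_sq_add_cos_sq z
  field_simp
  push_cast
  linear_combination -h3

lemma tendsto_normSq_sin_div : Tendsto
    (fun y : ℝ => (1 + 2 * Real.sinh y ^ 2 - shc y) / y ^ 2) (𝓝[>] 0) (𝓝 (4 / 3)) := by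
  have hle : 𝓝[>] (0 : ℝ) ≤ 𝓝[≠] 0 := nhdsWithin_mono 0 fun x (hx : 0 < x) => hx.ne'
  have h2y : Tendsto (fun y : ℝ => 2 * y) (𝓝[>] 0) (𝓝[≠] 0) := by
    refine tendsto_nhdsWithin_iff.2 ⟨?_, ?_⟩
    · have : Tendsto (fun y : ℝ => 2 * y) (𝓝 0) (𝓝 (2 * 0)) := Continuous.tendsto (by fun_prop) 0
      rw [mul_zero] at this
      exact this.mono_left nhdsWithin_le_nhds
    · filter_upwards [self_mem_nhdsWithin] with y hy
      have hy' : 0 < y := hy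
      have : 2 * y ≠ 0 := by positivity
      simpa using this
  have h1 := ((tendsto_sinh_div.mono_left hle).pow 2).const_mul 2
  have h2 := (tendsto_sinh_sub_self_div.comp h2y).const_mul 4
  have h3 := h1.sub h2
  have h4 : (2 * 1 ^ 2 - 4 * (1 / 2 / 3) : ℝ) = 4 / 3 := by norm_num
  rw [h4] at h3
  refine h3.congr' ?_
  filter_upwards [self_mem_nhdsWithin] with y hy
  have hy' : 0 < y := hy
  simp only [Function.comp]
  rw [shc_of_ne hy'.ne']
  field_simp
  ring

/-- The cube of the density at `t = 1`. With `y = Im ζ_1(θ / 2)`, the relation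
`sinh (2 y) / (2 y) = |cos ζ|²` gives `|sin ζ|² ∼ 4 y² / 3`, while `θ / 2 = ζ - tan ζ ∼ -ζ³ / 3`. -/
lemma tendsto_cube_angularDensity_one : Tendsto
    (fun θ : ℝ => (2 * Real.pi * angularDensity 1 θ) ^ 3 * |θ|) (𝓝[≠] 0) (𝓝 (√3 / 4)) := by
  have ht : (0 : ℝ) < 1 := one_pos
  set Z : ℝ → ℂ := fun θ => zeta 1 ((θ / 2 : ℝ) : ℂ)
  have hpi := Real.pi_pos
  have hZ0 : Z 0 = 0 := by
    have : zeta 1 0 = 0 := by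
      apply zeta_eq ht
      · refine ⟨by simp, ?_⟩
        simp [shc_zero]
      · simp [tanMap]
    simpa [Z] using this
  have hsmall : ∀ᶠ θ : ℝ in 𝓝[≠] 0, |θ| ≤ Real.pi := by
    apply mem_nhdsWithin_of_mem_nhds
    have h := (continuous_abs.tendsto (0 : ℝ)).eventually (gt_mem_nhds (by simpa using hpi))
    exact h.mono fun x hx => le_of_lt hx
  have hpos : ∀ᶠ θ : ℝ in 𝓝[≠] 0, 0 < (Z θ).im := by
    filter_upwards [hsmall, self_mem_nhdsWithin] with θ h1 h2
    have h2' : θ ≠ 0 := h2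
    have h3 : |θ / 2| = |θ| / 2 := by rw [abs_div, abs_of_pos (two_pos : (0 : ℝ) < 2)]
    exact im_zeta_pos ht le_rfl (by rw [h3]; linarith) (by rw [edge_one, h3]; positivity)
  have hZ : Tendsto Z (𝓝[≠] 0) (𝓝 0) := by
    have h := tendsto_zeta_half ht 0
    change Tendsto Z (𝓝 0) (𝓝 (Z 0)) at h
    rw [hZ0] at h
    exact h.mono_left nhdsWithin_le_nhds
  have hZne : Tendsto Z (𝓝[≠] 0) (𝓝[≠] 0) :=
    tendsto_nhdsWithin_iff.2 ⟨hZ, hpos.mono fun θ h h0 => by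
      have h0' : Z θ = 0 := h0
      rw [h0', Complex.zero_im] at h; exact lt_irrefl _ h⟩
  have hY0 : Tendsto (fun θ => (Z θ).im) (𝓝[≠] 0) (𝓝 0) := by
    have := (Complex.continuous_im.tendsto 0).comp hZ
    rwa [Complex.zero_im] at this
  have hY : Tendsto (fun θ => (Z θ).im) (𝓝[≠] 0) (𝓝[>] 0) :=
    tendsto_nhdsWithin_iff.2 ⟨hY0, hpos⟩
  have hN : ∀ᶠ θ : ℝ in 𝓝[≠] 0, ‖Complex.sin (Z θ)‖ ^ 2 =
      1 + 2 * Real.sinh (Z θ).im ^ 2 - shc (Z θ).im := by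
    filter_upwards [hpos] with θ h
    have hF := congrArg Complex.im (tanMap_zeta ht (θ := ((θ / 2 : ℝ) : ℂ)) (by simp))
    rw [im_tanMap, Complex.ofReal_im] at hF
    have h1 := (mul_eq_zero.1 hF).resolve_left h.ne'
    have h2 : 0 < Complex.normSq (Complex.cos (Z θ)) :=
      Complex.normSq_pos.2 (cos_ne_zero_of_im_pos h)
    have h3 : shc (Z θ).im = Complex.normSq (Complex.cos (Z θ)) := by
      rw [one_mul, sub_eq_zero] at h1
      exact ((div_eq_one_iff_eq h2.ne').1 h1.symm)
    rw [h3, ← Complex.normSq_eq_norm_sq, normSq_sin, normSq_cos]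
    linarith [Real.sin_sq_add_cos_sq (Z θ).re]
  have hratio : Tendsto (fun θ => ‖Complex.sin (Z θ)‖ / (Z θ).im) (𝓝[≠] 0) (𝓝 (2 / √3)) := by
    have h1 := (tendsto_normSq_sin_div.comp hY).sqrt
    have h2 : √(4 / 3) = 2 / √3 := by
      rw [Real.sqrt_div (by norm_num), show (4 : ℝ) = 2 ^ 2 by norm_num,
        Real.sqrt_sq (by norm_num)]
    rw [h2] at h1
    refine h1.congr' ?_
    filter_upwards [hpos, hN] with θ h h3
    simp only [Function.comp]
    rw [← h3, Real.sqrt_div (sq_nonneg _), Real.sqrt_sq (norm_nonneg _), Real.sqrt_sq h.le]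
  have hF : Tendsto (fun θ : ℝ => |θ| / ‖Z θ‖ ^ 3) (𝓝[≠] 0) (𝓝 (2 * ‖(-1 / 3 : ℂ)‖)) := by
    have h1 := ((tendsto_tanMap_one_div_cube.comp hZne).norm).const_mul 2
    refine h1.congr fun θ => ?_
    simp only [Function.comp, Z]
    rw [tanMap_zeta ht (by simp), norm_div, norm_pow, Complex.norm_real, Real.norm_eq_abs, abs_div,
      abs_of_pos (two_pos : (0 : ℝ) < 2)]
    ring
  have hS : Tendsto (fun θ : ℝ => ‖Complex.sin (Z θ)‖ / ‖Z θ‖) (𝓝[≠] 0) (𝓝 1) := by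
    have h1 := (tendsto_sin_div.comp hZne).norm
    rw [norm_one] at h1
    refine h1.congr fun θ => ?_
    simp only [Function.comp, norm_div]
  have hshc : Tendsto (fun θ => shc (Z θ).im) (𝓝[≠] 0) (𝓝 1) := by
    have := (continuous_shc.tendsto 0).comp hY0
    rwa [shc_zero] at this
  -- with `y = Im ζ`, `2π f = y shc y / |sin ζ|²`; its cube times `|θ|` is the product of
  -- `(shc y)³`, `(y / |sin ζ|)³`, `|θ| / |ζ|³` and `(|ζ| / |sin ζ|)³`
  have htot := ((hshc.pow 3).mul ((hratio.inv₀ (by positivity)).pow 3)).mul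
    (hF.mul ((hS.inv₀ one_ne_zero).pow 3))
  have hval : (1 : ℝ) ^ 3 * (2 / √3)⁻¹ ^ 3 * (2 * ‖(-1 / 3 : ℂ)‖ * 1⁻¹ ^ 3) = √3 / 4 := by
    have h1 : ‖(-1 / 3 : ℂ)‖ = 1 / 3 := by
      rw [norm_div, norm_neg, norm_one, Complex.norm_ofNat]
    rw [h1, inv_div]
    have h2 : √3 ^ 2 = 3 := Real.sq_sqrt (by norm_num)
    field_simp
    rw [h2]
    norm_num
  rw [hval] at htot
  refine htot.congr' ?_
  filter_upwards [hpos] with θ h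
  have hzn : ‖Z θ‖ ≠ 0 := norm_ne_zero_iff.2 fun h0 => by
    rw [h0, Complex.zero_im] at h; exact lt_irrefl _ h
  rw [angularDensity_eq_shc ht, Complex.normSq_eq_norm_sq]
  change _ = (2 * Real.pi * (1 / (2 * Real.pi) * ((Z θ).im * shc (Z θ).im /
    ‖Complex.sin (Z θ)‖ ^ 2))) ^ 3 * |θ|
  field_simp

lemma isEquivalent_angularDensity_one : Asymptotics.IsEquivalent (𝓝[≠] (0 : ℝ)) (angularDensity 1)
    (fun θ => 1 / (2 * Real.pi) * (√3 / (4 * |θ|)) ^ (1 / 3 : ℝ)) := by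
  have hne : ∀ᶠ θ : ℝ in 𝓝[≠] 0,
      1 / (2 * Real.pi) * (√3 / (4 * |θ|)) ^ (1 / 3 : ℝ) ≠ 0 := by
    filter_upwards [self_mem_nhdsWithin] with θ hθ
    have := abs_pos.2 (show θ ≠ 0 from hθ)
    positivity
  rw [Asymptotics.isEquivalent_iff_tendsto_one hne]
  have h1 := (tendsto_cube_angularDensity_one.mul_const (4 / √3)).rpow_const
    (p := (1 / 3 : ℝ)) (.inr (by norm_num))
  have h2 : (√3 / 4 * (4 / √3)) ^ (1 / 3 : ℝ) = 1 := by
    rw [show √3 / 4 * (4 / √3) = 1 by field_simp, Real.one_rpow]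
  rw [h2] at h1
  refine h1.congr' ?_
  filter_upwards [self_mem_nhdsWithin] with θ hθ
  have hθ' := abs_pos.2 (show θ ≠ 0 from hθ)
  have hd : 0 ≤ angularDensity 1 θ := ENNReal.toReal_nonneg
  have hq : 0 < √3 / (4 * |θ|) := by positivity
  have e1 : (2 * Real.pi * angularDensity 1 θ) ^ 3 * |θ| * (4 / √3) =
      (2 * Real.pi * angularDensity 1 θ) ^ 3 / (√3 / (4 * |θ|)) := by
    field_simp
  rw [e1, Real.div_rpow (by positivity) hq.le, ← Real.rpow_natCast, ← Real.rpow_mul (by positivity)]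
  have e2 : ((3 : ℕ) : ℝ) * (1 / 3) = 1 := by norm_num
  rw [e2, Real.rpow_one, Pi.div_apply]
  field_simp

end FreePoisson

theorem mainTheorem6 (t : ℝ) (ht : 0 < t) :
    -- the principal branch `ζ_t` and the function `r_t` are well defined
    ((∀ θ : ℂ, 0 < θ.im →
        0 < (zeta t θ).im ∧ zeta t θ - t * Complex.tan (zeta t θ) = θ ∧
        ∀ w : ℂ, 0 < w.im → w - t * Complex.tan w = θ → w = zeta t θ) ∧
      AnalyticOnNhd ℂ (zeta t) {θ : ℂ | 0 < θ.im} ∧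
      ContinuousOn (zeta t) {θ : ℂ | 0 ≤ θ.im} ∧
      (∀ θ : ℂ, 0 ≤ θ.im →
        zeta t θ = θ + Complex.I * t * r t (Complex.exp (2 * Complex.I * θ))) ∧
      AnalyticOnNhd ℂ (r t) (Metric.ball 0 1) ∧
      ContinuousOn (r t) (Metric.closedBall 0 1)) ∧
    -- the free unitary Poisson distribution exists, is unique, and has the following properties
    (∃! P : Measure Circle, IsFreeUnitaryPoisson t P) ∧
    ∀ P : Measure Circle, IsFreeUnitaryPoisson t P →
      -- the two formulas for the density
      (∀ θ : ℝ, (1 < t ∨ Circle.exp θ ≠ 1) →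
        angularDensity t θ = 1 / (2 * Real.pi) * (1 / r t (Circle.exp θ : ℂ)).re ∧
        angularDensity t θ = -(1 / (2 * Real.pi)) * (Complex.cot (zeta t ((θ / 2 : ℝ) : ℂ))).im) ∧
      -- the case `t > 1`
      (1 < t →
        P ≪ lengthMeasure ∧
        P = lengthMeasure.withDensity (density t) ∧
        AnalyticOnNhd ℝ (angularDensity t) univ ∧
        ∀ θ : ℝ, 0 < angularDensity t θ) ∧
      -- the case `t ≤ 1`
      (t ≤ 1 →
        P = ENNReal.ofReal (1 - t) • Measure.dirac (1 : Circle) +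
          lengthMeasure.withDensity (density t) ∧
        density t 1 = if t < 1 then 0 else ⊤) ∧
      -- the density for `t < 1`
      (t < 1 →
        edge t = Real.pi / 2 - ∫ u in (0 : ℝ)..t, √((1 - u) / u) ∧
        IntervalIntegrable (fun u : ℝ => √((1 - u) / u)) volume 0 t ∧
        0 < edge t ∧ edge t < Real.pi / 2 ∧
        ContinuousOn (angularDensity t) (Icc (-Real.pi) Real.pi) ∧
        (∀ θ ∈ Icc (-(2 * edge t)) (2 * edge t), angularDensity t θ = 0) ∧
        (∀ θ ∈ Icc (-Real.pi) Real.pi \ Icc (-(2 * edge t)) (2 * edge t),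
          AnalyticAt ℝ (angularDensity t) θ ∧ 0 < angularDensity t θ) ∧
        HasSqrtEdge (fun s => angularDensity t (2 * edge t + s)) ∧
        HasSqrtEdge (fun s => angularDensity t (-(2 * edge t) - s))) ∧
      -- the density for `t = 1`
      (t = 1 →
        (∀ θ ∈ Icc (-Real.pi) Real.pi \ {0},
          AnalyticAt ℝ (angularDensity t) θ ∧ 0 < angularDensity t θ) ∧
        Asymptotics.IsEquivalent (𝓝[≠] (0 : ℝ)) (angularDensity t)
          (fun θ => 1 / (2 * Real.pi) * (√3 / (4 * |θ|)) ^ (1 / 3 : ℝ))) := by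
  obtain ⟨P₀, hP₀, hz, hdec⟩ := exists_herglotz_poisson ht
  have hFP : IsFreeUnitaryPoisson t P₀ := isFreeUnitaryPoisson_of_herglotz ht hz
  refine ⟨⟨fun θ hθ => ⟨zeta_im_pos ht hθ, tanMap_zeta ht hθ.le, fun w hw h =>
    (zeta_eq ht (mem_region_of_im_tanMap_nonneg hw (by
      rw [tanMap, h]; exact hθ.le)) h).symm⟩, fun θ hθ => analyticAt_zeta ht hθ,
    continuousOn_zeta ht, fun θ hθ => ?_, analyticOnNhd_r ht, continuousOn_r ht⟩,
    ⟨P₀, hFP, fun Q hQ => hQ.unique hFP⟩, ?_⟩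
  · have h := tanMap_zeta ht hθ
    rw [tanMap] at h
    rw [r_exp ht hθ]
    linear_combination h + t * Complex.tan (zeta t θ) * Complex.I_sq
  intro P hP
  obtain rfl : P = P₀ := hP.unique hFP
  refine ⟨fun θ _ => ⟨angularDensity_eq_inv_r ht θ, angularDensity_eq_cot ht θ⟩, ?_, ?_, ?_, ?_⟩
  · intro h
    have hdec' : P = lengthMeasure.withDensity (density t) := by
      rw [ENNReal.ofReal_of_nonpos (by linarith), zero_smul, zero_add] at hdec
      exact hdec
    have han (θ : ℝ) := analyticAt_angularDensity ht
      (im_zeta_pos_of_one_lt h (θ := ((θ / 2 : ℝ) : ℂ)) (by simp))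
    refine ⟨?_, hdec', fun θ _ => (han θ).1, fun θ => (han θ).2⟩
    rw [hdec']
    exact withDensity_absolutelyContinuous _ _
  · intro h
    exact ⟨hdec, by rw [density, if_pos ⟨h, rfl⟩]⟩
  · intro h
    have hout : ∀ θ ∈ Icc (-Real.pi) Real.pi \ Icc (-(2 * edge t)) (2 * edge t),
        AnalyticAt ℝ (angularDensity t) θ ∧ 0 < angularDensity t θ := by
      rintro θ ⟨h1, h2⟩
      refine analyticAt_angularDensity_of_edge_lt ht h.le (abs_le.2 h1) ?_
      by_contra hcon
      exact h2 (abs_le.1 (not_lt.1 hcon))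
    exact ⟨edge_eq_integral ht h, intervalIntegrable_edge ht h, edge_pos ht h, edge_lt ht,
      fun θ hθ => (continuousAt_angularDensity ht h (abs_le.2 hθ)).continuousWithinAt,
      fun θ hθ => angularDensity_eq_zero ht h.le (abs_le.2 hθ), hout,
      hasSqrtEdge_right ht h, hasSqrtEdge_left ht h⟩
  · rintro rfl
    refine ⟨fun θ hθ => ?_, isEquivalent_angularDensity_one⟩
    refine analyticAt_angularDensity_of_edge_lt ht le_rfl (abs_le.2 hθ.1) ?_
    rw [edge_one, mul_zero]
    exact abs_pos.2 hθ.2
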